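/- All manifolds and Lie groups are modelled on real Hausdorff locally convex spaces; smoothness is understood in the sense of differential calculus on locally convex spaces: a map is $C^1$ if it is continuous and its directional derivatives exist and define a continuous map $df(x).v$ of $(x,v)$; it is $C^{n+1}$ if it is $C^1$ and $df$ is $C^n$; and smooth if it is $C^n$ for all $n$. For a smooth map $f$, $T^2f(v)=\tfrac12 d^2f(v,v)$ denotes its second order Taylor monomial at the base point, in charts. The Lie bracket on $L(G)=T_eG$ is $[x,y]=T^2m(x,y)-T^2m(y,x)$, where $m$ is the group multiplication. Let $G$ be a simply connected Lie group with Lie algebra $\mathfrak g$, let $\mathfrak z$ be a sequentially complete locally convex space, and let $\tau\colon A\to\mathfrak z$ be a smooth homomorphism from an abelian Lie group $A$ (for instance a discrete one) such that $\tau(A)\subseteq\mathfrak z$ is discrete. Let $\mathcal Z$ be the associated strict abelian Lie 2-group: its objects are the $x\in\mathfrak z$, its morphisms are $(a,x)\colon x\to\tau(a)+x$ with $a\in A$, and its multiplication is addition. Let $\omega\colon\mathfrak g\times\mathfrak g\to\mathfrak z$ be a continuous Lie algebra cocycle, and let $(F,\Theta)$ be a smooth $\mathcal Z$-valued generalised cocycle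 on $G$, i.e. a pair of maps $F\colon G^2\to\mathfrak z$, $\Theta\colon G^3\to A$ which vanish if one argument is $e$, are smooth on a unit neighbourhood, and satisfy $$F(h,k)-F(gh,k)+F(g,hk)-F(g,h)=\tau(\Theta(g,h,k)),$$ $$\Theta(h,k,l)-\Theta(gh,k,l)+\Theta(g,hk,l)-\Theta(g,h,kl)+\Theta(g,h,k)=0.$$ Suppose that $(F,\Theta)$ integrates $\omega$, i.e. that $L(F)(x,y):=T^2F(x,y)-T^2F(y,x)$ and $\omega$ differ by $(x,y)\mapsto b([x,y])$ for some continuous linear map $b\colon\mathfrak g\to\mathfrak z$. Let $\widehat{\mathcal G}=\widehat{\mathcal G}_{(F,\Theta)}$ be the 2-group with objects $(x,g)\in\mathfrak z\times G$, morphisms $(a,x,g)\colon(x,g)\to(\tau(a)+x,g)$ for $a\in A$, multiplication functor $(a,x,g)\otimes(b,y,h)=(a+b,\,x+y+F(g,h),\,gh)$ and associator $(\Theta(g,h,k),\,x+y+z+F(g,h)+F(gh,k),\,ghk)$ at $(x,g),(y,h),(z,k)$. Write $\operatorname{skel}$ for the group of isomorphism classes of objects, so that $\operatorname{skel}(\mathcal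 Z)\cong\mathfrak z/\tau(A)$. The band of $\widehat{\mathcal G}$ is the sequence $$\mathfrak z/\tau(A)\xrightarrow{[x]\mapsto[(x,e)]}\operatorname{skel}(\widehat{\mathcal G})\xrightarrow{[(x,g)]\mapsto g}G.$$ Then: 1. There is a Lie group structure on $\mathfrak z/\tau(A)$, modelled on $\mathfrak z$, for which the quotient map $\mathfrak z\to\mathfrak z/\tau(A)$ is a local diffeomorphism, and a Lie group structure on $\operatorname{skel}(\widehat{\mathcal G})$, modelled on $\mathfrak z\times\mathfrak g$, for which $\mathfrak z\times G\to\operatorname{skel}(\widehat{\mathcal G})$, $(x,g)\mapsto[(x,g)]$, is a local diffeomorphism at $(0,e)$. Both are unique: any two such structures coincide, in the sense that the identity map is a diffeomorphism. 2. With these structures, $\operatorname{skel}(\widehat{\mathcal G})\to G$ is a smooth principal $\mathfrak z/\tau(A)$-bundle. 3. The band is a central extension of Lie groups, i.e. a short exact sequence of smooth homomorphisms with central kernel and with a smooth section on a unit neighbourhood of $G$. 4. The band integrates $\mathfrak z\to\mathfrak z\oplus_\omega\mathfrak g\to\mathfrak g$: let $\mathfrak z\oplus_\omega\mathfrak g$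 be $\mathfrak z\times\mathfrak g$ with bracket $[(z,x),(w,y)]=(\omega(x,y),[x,y])$, and identify $\mathfrak z$ with $L(\mathfrak z/\tau(A))$ by the differential of the quotient map. Then there is an isomorphism of topological Lie algebras $\mathfrak z\oplus_\omega\mathfrak g\cong L(\operatorname{skel}(\widehat{\mathcal G}))$ compatible with the maps from $\mathfrak z$ and the maps to $\mathfrak g$. -/

import Mathlib

open Set Filter Topology CategoryTheory MonoidalCategory

noncomputable section

/-! ### Differential calculus on locally convex spaces -/

section Calculus

/-- `f` is of class `C^n` on the open set `U`, in the sense of differential calculus on locally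
convex spaces: `f` is continuous on `U` and, if `n > 0`, all directional derivatives
`df (x, v) = lim_{t → 0} (f (x + t v) - f x) / t` exist for `x ∈ U` and define a map
`df : U × E → F` of class `C^(n-1)`. -/
def LCContDiffOn {F : Type*} [AddCommGroup F] [Module ℝ F] [TopologicalSpace F] :
    (n : ℕ) → {E : Type*} → [AddCommGroup E] → [Module ℝ E] → [TopologicalSpace E] →
      (U : Set E) → (f : E → F) → Prop
  | 0, _, _, _, _, U, f => ContinuousOn f U
  | n + 1, E, _, _, _, U, f => ContinuousOn f U ∧ ∃ df : E × E → F,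
      (∀ x ∈ U, ∀ v : E, Tendsto (fun t : ℝ => t⁻¹ • (f (x + t • v) - f x)) (𝓝[≠] 0)
        (𝓝 (df (x, v)))) ∧
      LCContDiffOn n (U ×ˢ (univ : Set E)) df

variable {E F : Type*} [AddCommGroup E] [Module ℝ E] [TopologicalSpace E]
  [AddCommGroup F] [Module ℝ F] [TopologicalSpace F]

/-- Smoothness (class `C^n` for all `n`) on the open set `U`. -/
def LCSmoothOn (U : Set E) (f : E → F) : Prop := ∀ n : ℕ, LCContDiffOn n U f

/-- The directional derivative `df(x).v`. -/
def dirDeriv (f : E → F) (x v : E) : F :=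
  limUnder (𝓝[≠] (0 : ℝ)) (fun t : ℝ => t⁻¹ • (f (x + t • v) - f x))

end Calculus

/-! ### Manifolds and Lie groups modelled on locally convex spaces -/

/-- The product of two charted spaces, with the product vector space as model. -/
instance lcProdChartedSpace (E E' M N : Type*) [TopologicalSpace E] [TopologicalSpace E']
    [TopologicalSpace M] [TopologicalSpace N] [ChartedSpace E M] [ChartedSpace E' N] :
    ChartedSpace (E × E') (M × N) :=
  inferInstanceAs (ChartedSpace (ModelProd E E') (M × N))

section Manifolds

variable (E E' : Type*) [AddCommGroup E] [Module ℝ E] [TopologicalSpace E]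
  [AddCommGroup E'] [Module ℝ E'] [TopologicalSpace E']
  {M N : Type*} [TopologicalSpace M] [TopologicalSpace N] [ChartedSpace E M] [ChartedSpace E' N]

/-- `M` is a (Hausdorff) manifold modelled on `E`: all coordinate changes are smooth. -/
class LCManifold (M : Type*) [TopologicalSpace M] [ChartedSpace E M] : Prop where
  t2 : T2Space M
  smooth_coordChange : ∀ e ∈ atlas E M, ∀ e' ∈ atlas E M,
    LCSmoothOn (e.symm.trans e').source (e' ∘ e.symm)

/-- The expression of `f` in the preferred charts at `p` and `f p`. -/
def chartExpr (f : M → N) (p : M) : E → E' :=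
  chartAt E' (f p) ∘ f ∘ (chartAt E p).symm

/-- `f` is smooth on a neighbourhood of `p`, in charts. -/
def LCSmoothAt (f : M → N) (p : M) : Prop :=
  ContinuousAt f p ∧ ∃ W : Set E, IsOpen W ∧ chartAt E p p ∈ W ∧ W ⊆ (chartAt E p).target ∧
    LCSmoothOn W (chartExpr E E' f p)

/-- `f` is smooth. -/
def LCSmooth (f : M → N) : Prop := ∀ p, LCSmoothAt E E' f p

/-- `f` restricts to a diffeomorphism from the open set `U` onto the open set `V`. -/
def IsDiffeoOn (f : M → N) (U : Set M) (V : Set N) : Prop :=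
  IsOpen U ∧ IsOpen V ∧ ∃ g : N → M, MapsTo f U V ∧ MapsTo g V U ∧ LeftInvOn g f U ∧
    RightInvOn g f V ∧ (∀ p ∈ U, LCSmoothAt E E' f p) ∧ (∀ q ∈ V, LCSmoothAt E' E g q)

/-- `f` is a local diffeomorphism at `p`. -/
def IsLCLocalDiffeoAt (f : M → N) (p : M) : Prop :=
  ∃ (U : Set M) (V : Set N), p ∈ U ∧ IsDiffeoOn E E' f U V

/-- The differential of `f` at `p`, where the tangent spaces `T_p M` and `T_{f p} N` are identified
with the model spaces by means of the preferred charts. -/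
def tangentAt (f : M → N) (p : M) (v : E) : E' :=
  dirDeriv (chartExpr E E' f p) (chartAt E p p) v

/-- The second order Taylor monomial `v ↦ ½ d²f(v, v)` of `f` at `p`, in the preferred charts. -/
def taylorTwo (f : M → N) (p : M) (v : E) : E' :=
  (1 / 2 : ℝ) • dirDeriv (fun x => dirDeriv (chartExpr E E' f p) x v) (chartAt E p p) v

/-- A Lie group modelled on `E`. -/
class LCLieGroup (G : Type*) [Group G] [TopologicalSpace G] [ChartedSpace E G] : Prop
    extends LCManifold E G where
  smooth_mul : LCSmooth (E × E) E (fun p : G × G => p.1 * p.2)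
  smooth_inv : LCSmooth E E (fun g : G => g⁻¹)

/-- An additively written Lie group modelled on `E`. -/
class LCLieAddGroup (A : Type*) [AddGroup A] [TopologicalSpace A] [ChartedSpace E A] : Prop
    extends LCManifold E A where
  smooth_add : LCSmooth (E × E) E (fun p : A × A => p.1 + p.2)
  smooth_neg : LCSmooth E E (fun a : A => -a)

/-- For a map `f` on `G × G`, the anti-symmetrisation `T²f(x, y) - T²f(y, x)` of its second order
Taylor monomial at the unit, where `x, y ∈ T_1 G`. -/
def antisymTaylor {G : Type*} [Group G] [TopologicalSpace G] [ChartedSpace E G]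
    (f : G × G → N) (x y : E) : E' :=
  taylorTwo (E × E) E' f 1 (x, y) - taylorTwo (E × E) E' f 1 (y, x)

/-- The bracket of the Lie algebra `L(G) = T_1 G`, the latter being identified with `E` by means of
the preferred chart at `1`: the anti-symmetrised second order Taylor monomial of the group
multiplication. -/
def lieAlgBracket (G : Type*) [Group G] [TopologicalSpace G] [ChartedSpace E G] (x y : E) : E :=
  antisymTaylor E E (fun p : G × G => p.1 * p.2) x y

end Manifolds

/-- The structure of a Lie group modelled on `E` on a given group `B`. -/
structure LieStructure (E : Type*) [AddCommGroup E] [Module ℝ E] [TopologicalSpace E]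
    (B : Type*) [Group B] where
  top : TopologicalSpace B
  charts : ChartedSpace E B
  isLie : LCLieGroup E B

namespace LieStructure

variable {E : Type*} [AddCommGroup E] [Module ℝ E] [TopologicalSpace E] {B : Type*} [Group B]

/-- The group `B`, equipped with the Lie group structure `S`. -/
def Carrier (_S : LieStructure E B) : Type _ := B

instance (S : LieStructure E B) : Group S.Carrier := inferInstanceAs (Group B)
instance (S : LieStructure E B) : TopologicalSpace S.Carrier := S.top
instance (S : LieStructure E B) : ChartedSpace E S.Carrier := S.charts
instance (S : LieStructure E B) : LCLieGroup E S.Carrier := S.isLie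

/-- The identity of `B`, as a map between the Lie groups given by two structures on `B`. -/
def idMap (S T : LieStructure E B) : S.Carrier → T.Carrier := fun b => b

/-- Two Lie group structures on `B` coincide if the identity of `B` is a diffeomorphism. -/
def Coincide (S T : LieStructure E B) : Prop :=
  LCSmooth E E (S.idMap T) ∧ LCSmooth E E (T.idMap S)

end LieStructure

section Bundles

variable (EH EP EM : Type*) [AddCommGroup EH] [Module ℝ EH] [TopologicalSpace EH]
  [AddCommGroup EP] [Module ℝ EP] [TopologicalSpace EP]
  [AddCommGroup EM] [Module ℝ EM] [TopologicalSpace EM]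
  {H P M : Type*} [Group H] [TopologicalSpace H] [ChartedSpace EH H]
  [TopologicalSpace P] [ChartedSpace EP P] [TopologicalSpace M] [ChartedSpace EM M]

/-- `π : P → M`, with the action `act` of the Lie group `H` on `P`, is a smooth principal
`H`-bundle: the action and the projection are smooth, and `M` is covered by open sets `U` that
admit an `H`-equivariant diffeomorphism `H × U → π⁻¹(U)` over `U`. -/
structure IsSmoothPrincipalBundle (act : H → P → P) (π : P → M) : Prop where
  one_act : ∀ b, act 1 b = b
  mul_act : ∀ h h' b, act (h * h') b = act h (act h' b)
  smooth_act : LCSmooth (EH × EP) EP (fun p : H × P => act p.1 p.2)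
  smooth_proj : LCSmooth EP EM π
  locally_trivial : ∀ m : M, ∃ U : Set M, IsOpen U ∧ m ∈ U ∧ ∃ φ : H × M → P,
    IsDiffeoOn (EH × EM) EP φ ((univ : Set H) ×ˢ U) (π ⁻¹' U) ∧
    (∀ h : H, ∀ u ∈ U, π (φ (h, u)) = u) ∧
    (∀ h h' : H, ∀ u ∈ U, φ (h * h', u) = act h (φ (h', u)))

/-- `H → P → M` is a central extension of Lie groups: a short exact sequence of smooth
homomorphisms with central kernel which admits a smooth section on some unit neighbourhood. -/
structure IsCentralLieExtension [Group P] [Group M] (κ : H →* P) (π : P →* M) : Prop where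
  injective : Function.Injective κ
  exact : κ.range = π.ker
  surjective : Function.Surjective π
  central : κ.range ≤ Subgroup.center P
  smooth_incl : LCSmooth EH EP κ
  smooth_proj : LCSmooth EP EM π
  local_section : ∃ (U : Set M) (σ : M → P), IsOpen U ∧ 1 ∈ U ∧
    (∀ u ∈ U, LCSmoothAt EM EP σ u ∧ π (σ u) = u)

end Bundles

/-! ### Lie algebra cocycles -/

section LieCocycles

variable {𝔤 𝔷 : Type*} [AddCommGroup 𝔤] [Module ℝ 𝔤] [TopologicalSpace 𝔤]
  [AddCommGroup 𝔷] [Module ℝ 𝔷] [TopologicalSpace 𝔷]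

/-- The bilinear map `ω` is a continuous cocycle on the Lie algebra `𝔤` with bracket `br`. -/
structure IsLieCocycle (br : 𝔤 → 𝔤 → 𝔤) (ω : 𝔤 →ₗ[ℝ] 𝔤 →ₗ[ℝ] 𝔷) : Prop where
  cont : Continuous (fun p : 𝔤 × 𝔤 => ω p.1 p.2)
  antisymm : ∀ x y, ω x y = -ω y x
  cocycle : ∀ x y z, ω (br x y) z + ω (br y z) x + ω (br z x) y = 0

/-- Equivalence of two cocycles: they differ by `(x, y) ↦ b [x, y]` for some continuous linear
map `b`. -/
def LieCocycleEquiv (br : 𝔤 → 𝔤 → 𝔤) (ω ω' : 𝔤 → 𝔤 → 𝔷) : Prop :=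
  ∃ b : 𝔤 →L[ℝ] 𝔷, ∀ x y, ω x y = ω' x y + b (br x y)

/-- The bracket of the central extension `𝔷 ⊕_ω 𝔤`. -/
def extBracket (br : 𝔤 → 𝔤 → 𝔤) (ω : 𝔤 → 𝔤 → 𝔷) (p q : 𝔷 × 𝔤) : 𝔷 × 𝔤 :=
  (ω p.2 q.2, br p.2 q.2)

end LieCocycles

/-- Sequential completeness of a topological vector space. -/
def SeqComplete (V : Type*) [AddCommGroup V] [TopologicalSpace V] : Prop :=
  ∀ u : ℕ → V, Tendsto (fun p : ℕ × ℕ => u p.1 - u p.2) atTop (𝓝 0) →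
    ∃ a, Tendsto u atTop (𝓝 a)

/-! ### The strict abelian 2-group `𝒵_τ` -/

section StrictTwoGroup

variable {A Z : Type*} [AddCommGroup A] [AddCommGroup Z] (τ : A →+ Z)

/-- The objects of the 2-group `𝒵_τ` associated with the abelian crossed module `τ : A → Z`. -/
@[ext] structure StrictObj (τ : A →+ Z) where
  val : Z

variable {τ}

/-- The morphisms of `𝒵_τ` from `x` to `y` are the `a ∈ A` with `y = τ a + x`. -/
@[ext] structure StrictObj.Hom (x y : StrictObj τ) where
  a : A
  tgt : y.val = τ a + x.val

instance : Category (StrictObj τ) where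
  Hom := StrictObj.Hom
  id x := ⟨0, by simp⟩
  comp f g := ⟨g.a + f.a, by rw [g.tgt, f.tgt, map_add, add_assoc]⟩
  id_comp f := StrictObj.Hom.ext (add_zero _)
  comp_id f := StrictObj.Hom.ext (zero_add _)
  assoc f g h := StrictObj.Hom.ext (add_assoc _ _ _).symm

namespace StrictObj

@[ext] theorem hom_ext {x y : StrictObj τ} {f g : x ⟶ y} (h : f.a = g.a) : f = g :=
  StrictObj.Hom.ext h

@[simp] theorem comp_a {x y z : StrictObj τ} (f : x ⟶ y) (g : y ⟶ z) :
    (f ≫ g).a = g.a + f.a := rfl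

@[simp] theorem id_a (x : StrictObj τ) : Hom.a (𝟙 x) = 0 := rfl

/-- Every morphism of `𝒵_τ` is invertible. -/
def mkIso {x y : StrictObj τ} (a : A) (h : y.val = τ a + x.val) : x ≅ y where
  hom := ⟨a, h⟩
  inv := ⟨-a, by rw [h]; simp⟩
  hom_inv_id := by ext; simp
  inv_hom_id := by ext; simp

@[simp] theorem mkIso_hom_a {x y : StrictObj τ} (a : A) (h : y.val = τ a + x.val) :
    Hom.a (mkIso a h).hom = a := rfl

end StrictObj

instance : MonoidalCategory (StrictObj τ) where
  tensorObj x y := ⟨x.val + y.val⟩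
  tensorHom f g := ⟨f.a + g.a, by
    show _ + _ = _; rw [f.tgt, g.tgt, map_add, add_add_add_comm]⟩
  whiskerLeft x _ _ f := ⟨f.a, by show _ + _ = _; rw [f.tgt, add_left_comm]⟩
  whiskerRight f y := ⟨f.a, by show _ + _ = _; rw [f.tgt, add_assoc]⟩
  tensorUnit := ⟨0⟩
  associator x y z := StrictObj.mkIso 0 (by simp [add_assoc])
  leftUnitor x := StrictObj.mkIso 0 (by simp)
  rightUnitor x := StrictObj.mkIso 0 (by simp)
  tensorHom_def f g := by ext; exact add_comm _ _
  id_tensorHom_id _ _ := by ext; simp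
  tensorHom_comp_tensorHom f g h k := by ext; simp; abel
  whiskerLeft_id _ _ := by ext; simp
  id_whiskerRight _ _ := by ext; simp
  associator_naturality f g h := by ext; simp [add_assoc]
  leftUnitor_naturality f := by ext; simp
  rightUnitor_naturality f := by ext; simp
  pentagon _ _ _ _ := by ext; simp
  triangle _ _ := by ext; simp

end StrictTwoGroup

/-! ### Generalised cocycles and the 2-groups associated with them -/

/-- A generalised group 2-cocycle on `G` with values in the abelian 2-group of `τ : A → Z`: a pair
of normalised cochains `F`, `Θ` with `d F = τ ∘ Θ` and `d Θ = 0`. -/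
structure GenCocycle {A Z : Type*} [AddCommGroup A] [AddCommGroup Z] (τ : A →+ Z)
    (G : Type*) [Group G] where
  F : G → G → Z
  Θ : G → G → G → A
  F_one_left : ∀ g, F 1 g = 0
  F_one_right : ∀ g, F g 1 = 0
  Θ_one_left : ∀ g h, Θ 1 g h = 0
  Θ_one_mid : ∀ g h, Θ g 1 h = 0
  Θ_one_right : ∀ g h, Θ g h 1 = 0
  d_F : ∀ g h k, F h k - F (g * h) k + F g (h * k) - F g h = τ (Θ g h k)
  d_Θ : ∀ g h k l,
    Θ h k l - Θ (g * h) k l + Θ g (h * k) l - Θ g h (k * l) + Θ g h k = 0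

section CocycleTwoGroup

variable {A Z : Type*} [AddCommGroup A] [AddCommGroup Z] {τ : A →+ Z} {G : Type*} [Group G]

/-- The objects `(x, g) ∈ Z × G` of the 2-group associated with the generalised cocycle `c`. -/
@[ext] structure CocycleObj (c : GenCocycle τ G) where
  val : Z
  elt : G

variable {c : GenCocycle τ G}

/-- The morphisms `(a, x, g) : (x, g) → (τ a + x, g)`. -/
@[ext] structure CocycleObj.Hom (X Y : CocycleObj c) where
  a : A
  tgt : Y.val = τ a + X.val
  elt_eq : Y.elt = X.elt

instance : Category (CocycleObj c) where
  Hom := CocycleObj.Hom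
  id X := ⟨0, by simp, rfl⟩
  comp f g := ⟨g.a + f.a, by rw [g.tgt, f.tgt, map_add, add_assoc], by rw [g.elt_eq, f.elt_eq]⟩
  id_comp f := CocycleObj.Hom.ext (add_zero _)
  comp_id f := CocycleObj.Hom.ext (zero_add _)
  assoc f g h := CocycleObj.Hom.ext (add_assoc _ _ _).symm

namespace CocycleObj

@[ext] theorem hom_ext {X Y : CocycleObj c} {f g : X ⟶ Y} (h : f.a = g.a) : f = g :=
  CocycleObj.Hom.ext h

@[simp] theorem comp_a {X Y Z : CocycleObj c} (f : X ⟶ Y) (g : Y ⟶ Z) :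
    (f ≫ g).a = g.a + f.a := rfl

@[simp] theorem id_a (X : CocycleObj c) : Hom.a (𝟙 X) = 0 := rfl

/-- Every morphism is invertible. -/
def mkIso {X Y : CocycleObj c} (a : A) (h : Y.val = τ a + X.val) (h' : Y.elt = X.elt) :
    X ≅ Y where
  hom := ⟨a, h, h'⟩
  inv := ⟨-a, by rw [h]; simp, h'.symm⟩
  hom_inv_id := by ext; simp
  inv_hom_id := by ext; simp

@[simp] theorem mkIso_hom_a {X Y : CocycleObj c} (a : A) (h : Y.val = τ a + X.val)
    (h' : Y.elt = X.elt) : Hom.a (mkIso a h h').hom = a := rfl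

end CocycleObj

/-- The 2-group associated with the generalised cocycle `(F, Θ)`: the multiplication functor is
`(a, x, g) ⊗ (b, y, h) = (a + b, x + y + F(g, h), g h)`, the unit object is `(0, 1)`, and the
associator at `(x, g), (y, h), (z, k)` has `A`-component `Θ(g, h, k)`. -/
instance : MonoidalCategory (CocycleObj c) where
  tensorObj X Y := ⟨X.val + Y.val + c.F X.elt Y.elt, X.elt * Y.elt⟩
  tensorHom f g := ⟨f.a + g.a, by
    show _ + _ + c.F _ _ = _
    rw [f.tgt, g.tgt, map_add, f.elt_eq, g.elt_eq, add_add_add_comm, add_assoc], by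
    show _ * _ = _
    rw [f.elt_eq, g.elt_eq]⟩
  whiskerLeft X _ _ f := ⟨f.a, by
    show _ + _ + c.F _ _ = _
    rw [f.tgt, f.elt_eq, add_left_comm, add_assoc], by
    show _ * _ = _
    rw [f.elt_eq]⟩
  whiskerRight f Y := ⟨f.a, by
    show _ + _ + c.F _ _ = _
    rw [f.tgt, f.elt_eq, add_assoc, add_assoc, add_assoc], by
    show _ * _ = _
    rw [f.elt_eq]⟩
  tensorUnit := ⟨0, 1⟩
  associator X Y W := CocycleObj.mkIso (c.Θ X.elt Y.elt W.elt)
    (by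
      show X.val + (Y.val + W.val + c.F Y.elt W.elt) + c.F X.elt (Y.elt * W.elt) =
        τ _ + (X.val + Y.val + c.F X.elt Y.elt + W.val + c.F (X.elt * Y.elt) W.elt)
      rw [← c.d_F]; abel)
    (mul_assoc _ _ _).symm
  leftUnitor X := CocycleObj.mkIso 0 (by simp [c.F_one_left]) (by simp)
  rightUnitor X := CocycleObj.mkIso 0 (by simp [c.F_one_right]) (by simp)
  tensorHom_def f g := by ext; exact add_comm _ _
  id_tensorHom_id _ _ := by ext; simp
  tensorHom_comp_tensorHom f g h k := by ext; simp; abel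
  whiskerLeft_id _ _ := by ext; simp
  id_whiskerRight _ _ := by ext; simp
  associator_naturality f g h := by
    ext; simp [f.elt_eq, g.elt_eq, h.elt_eq]; abel
  leftUnitor_naturality f := by ext; simp
  rightUnitor_naturality f := by ext; simp
  pentagon X Y W V := by
    ext
    simp only [CocycleObj.comp_a, CocycleObj.mkIso_hom_a]
    have h := c.d_Θ X.elt Y.elt W.elt V.elt
    rw [← sub_eq_zero, ← h]
    abel
  triangle X Y := by ext; simp [c.Θ_one_mid]

namespace CocycleObj

@[simp] theorem whiskerLeft_a (X : CocycleObj c) {Y Y' : CocycleObj c} (f : Y ⟶ Y') :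
    Hom.a (X ◁ f) = f.a := rfl

@[simp] theorem whiskerRight_a {X X' : CocycleObj c} (f : X ⟶ X') (Y : CocycleObj c) :
    Hom.a (f ▷ Y) = f.a := rfl

@[simp] theorem associator_hom_a (X Y W : CocycleObj c) :
    Hom.a (α_ X Y W).hom = c.Θ X.elt Y.elt W.elt := rfl

@[simp] theorem leftUnitor_hom_a (X : CocycleObj c) : Hom.a (λ_ X).hom = 0 := rfl

@[simp] theorem rightUnitor_hom_a (X : CocycleObj c) : Hom.a (ρ_ X).hom = 0 := rfl

/-- The inverse object `(-x - F(g, g⁻¹), g⁻¹)` of `(x, g)`. -/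
def bar (X : CocycleObj c) : CocycleObj c := ⟨-X.val - c.F X.elt X.elt⁻¹, X.elt⁻¹⟩

/-- `X ⊗ bar X` is the unit object. -/
theorem tensor_bar (X : CocycleObj c) : X ⊗ bar X = 𝟙_ (CocycleObj c) :=
  CocycleObj.ext (show X.val + (-X.val - c.F X.elt X.elt⁻¹) + c.F X.elt X.elt⁻¹ = 0 by abel)
    (mul_inv_cancel X.elt)

/-- `bar X ⊗ X` is isomorphic to the unit object. -/
def barTensorIso (X : CocycleObj c) : bar X ⊗ X ≅ 𝟙_ (CocycleObj c) :=
  mkIso (-c.Θ X.elt X.elt⁻¹ X.elt) (by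
    show (0 : Z) = τ _ + (-X.val - c.F X.elt X.elt⁻¹ + X.val + c.F X.elt⁻¹ X.elt)
    rw [map_neg, ← c.d_F, mul_inv_cancel, inv_mul_cancel, c.F_one_left, c.F_one_right]
    abel) (inv_mul_cancel X.elt).symm

theorem bar_iso {X Y : CocycleObj c} (h : Nonempty (X ≅ Y)) : Nonempty (bar X ≅ bar Y) := by
  obtain ⟨i⟩ := h
  refine ⟨mkIso (-i.hom.a) ?_ ?_⟩
  · show -Y.val - c.F Y.elt Y.elt⁻¹ = _ + (-X.val - c.F X.elt X.elt⁻¹)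
    rw [map_neg, i.hom.tgt, i.hom.elt_eq, neg_add, sub_eq_add_neg, sub_eq_add_neg, add_assoc]
  · exact congrArg (fun g : G => g⁻¹) i.hom.elt_eq

end CocycleObj

/-- The group `skel` of isomorphism classes of objects of the 2-group of a generalised cocycle; the
multiplication is induced by `⊗`. -/
instance : Group (Skeleton (CocycleObj c)) :=
  { (inferInstance : Monoid (Skeleton (CocycleObj c))) with
    inv := Quotient.map' CocycleObj.bar fun _ _ h => CocycleObj.bar_iso h
    inv_mul_cancel := by
      intro b
      induction b using Quotient.inductionOn with
      | h X =>
        show toSkeleton (CocycleObj.bar X) * toSkeleton X = 1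
        rw [← Skeleton.toSkeleton_tensorObj, Skeleton.one_eq]
        exact congr_toSkeleton_of_iso (CocycleObj.barTensorIso X) }

/-- The embedding functor `x ↦ (x, 1)` of `𝒵_τ` into the 2-group of the cocycle. -/
def cocycleIncl (c : GenCocycle τ G) : StrictObj τ ⥤ CocycleObj c where
  obj x := ⟨x.val, 1⟩
  map f := ⟨f.a, f.tgt, rfl⟩
  map_id _ := rfl
  map_comp _ _ := rfl

instance : (cocycleIncl c).Monoidal :=
  Functor.CoreMonoidal.toMonoidal
    { εIso := CocycleObj.mkIso 0 (by simp [cocycleIncl]; rfl) rfl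
      μIso := fun x y => CocycleObj.mkIso 0 (by
        show x.val + y.val = τ 0 + (x.val + y.val + c.F 1 1)
        simp [c.F_one_left]) (by show (1 : G) = 1 * 1; simp)
      μIso_hom_natural_left := fun f _ => by
        ext; show (0 : A) + f.a = f.a + 0; simp
      μIso_hom_natural_right := fun _ f => by
        ext; show (0 : A) + f.a = f.a + 0; simp
      associativity := fun _ _ _ => by
        ext; show (0 : A) + 0 + 0 = 0 + 0 + c.Θ 1 1 1; simp [c.Θ_one_left]
      left_unitality := fun _ => by
        ext; show (0 : A) = 0 + 0 + 0; simp
      right_unitality := fun _ => by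
        ext; show (0 : A) = 0 + 0 + 0; simp }

/-- The projection functor `(x, g) ↦ g` of the 2-group of the cocycle onto the discrete category
`G`. -/
def cocycleProj (c : GenCocycle τ G) : CocycleObj c ⥤ Discrete G where
  obj X := Discrete.mk X.elt
  map f := Discrete.eqToHom f.elt_eq.symm

instance : (cocycleProj c).Monoidal :=
  Functor.CoreMonoidal.toMonoidal
    { εIso := Iso.refl _
      μIso := fun _ _ => Iso.refl _ }

/-! ### The band -/

/-- The canonical isomorphism between `Z / τ(A)` and the group of isomorphism classes of objects of
`𝒵_τ`, sending the class of `x ∈ Z` to the isomorphism class of `x`. -/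
def skelStrictEquiv (τ : A →+ Z) : Multiplicative (Z ⧸ τ.range) ≃* Skeleton (StrictObj τ) where
  toFun h := Quotient.map' (s₁ := QuotientAddGroup.leftRel τ.range)
    (s₂ := isIsomorphicSetoid (StrictObj τ)) (fun x => (⟨x⟩ : StrictObj τ))
    (by
      intro x y h
      obtain ⟨a, ha⟩ := QuotientAddGroup.leftRel_apply.mp h
      exact ⟨StrictObj.mkIso a (by show y = τ a + x; rw [ha]; abel)⟩) (Multiplicative.toAdd h)
  invFun b := Multiplicative.ofAdd (Quotient.map' (s₁ := isIsomorphicSetoid (StrictObj τ))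
    (s₂ := QuotientAddGroup.leftRel τ.range) (fun X : StrictObj τ => X.val)
    (by
      rintro X Y ⟨i⟩
      refine QuotientAddGroup.leftRel_apply.mpr ⟨i.hom.a, ?_⟩
      rw [i.hom.tgt]; abel) b)
  left_inv h := by
    induction h using Multiplicative.rec with
    | _ h =>
    induction h using Quotient.inductionOn' with
    | h x => rfl
  right_inv b := by
    induction b using Quotient.inductionOn with
    | h X => rfl
  map_mul' h k := by
    induction h using Multiplicative.rec with
    | _ h =>
    induction k using Multiplicative.rec with
    | _ k =>
    induction h using Quotient.inductionOn' with
    | h x =>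
    induction k using Quotient.inductionOn' with
    | h y => exact Skeleton.toSkeleton_tensorObj (⟨x⟩ : StrictObj τ) ⟨y⟩

/-- The group `skel` of isomorphism classes of objects of the 2-group associated with `c`, i.e. the
total group of the band. -/
abbrev Band (c : GenCocycle τ G) : Type _ := Skeleton (CocycleObj c)

/-- The isomorphism class of the object `(x, g)`. -/
def bandClass (c : GenCocycle τ G) (p : Z × G) : Band c :=
  toSkeleton (⟨p.1, p.2⟩ : CocycleObj c)

/-- The homomorphism `Z / τ(A) ≅ skel(𝒵_τ) → skel` induced by the embedding functor. -/
def bandIncl (c : GenCocycle τ G) : Multiplicative (Z ⧸ τ.range) →* Band c :=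
  (Skeleton.monoidHom (cocycleIncl c)).comp (skelStrictEquiv τ).toMonoidHom

/-- The isomorphism classes of objects of the discrete 2-group `G` form the group `G`. -/
def skelDiscreteHom (G : Type*) [Group G] : Skeleton (Discrete G) →* G where
  toFun b := Quotient.lift (s := isIsomorphicSetoid (Discrete G)) (fun X : Discrete G => X.as)
    (fun _ _ ⟨i⟩ => Discrete.eq_of_hom i.hom) b
  map_one' := rfl
  map_mul' b b' := by
    induction b using Quotient.inductionOn with
    | h X =>
    induction b' using Quotient.inductionOn with
    | h Y =>
    rw [← Skeleton.toSkeleton_tensorObj]; rfl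

/-- The homomorphism `skel → G` induced by the projection functor. -/
def bandProj (c : GenCocycle τ G) : Band c →* G :=
  (skelDiscreteHom G).comp (Skeleton.monoidHom (cocycleProj c))

end CocycleTwoGroup

/-! ### Smooth generalised cocycles and the Lie group structure of the band -/

section SmoothBand

variable (EA E : Type*) {𝔷 A G : Type*}
  [AddCommGroup EA] [Module ℝ EA] [TopologicalSpace EA]
  [AddCommGroup E] [Module ℝ E] [TopologicalSpace E]
  [AddCommGroup 𝔷] [Module ℝ 𝔷] [TopologicalSpace 𝔷]
  [AddCommGroup A] [TopologicalSpace A] [ChartedSpace EA A]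
  [Group G] [TopologicalSpace G] [ChartedSpace E G]
  {τ : A →+ 𝔷}

/-- The generalised cocycle `(F, Θ)` is smooth: `F` and `Θ` are smooth on some neighbourhood of the
unit. -/
structure GenCocycle.IsSmooth (c : GenCocycle τ G) : Prop where
  smooth_F : ∀ᶠ p in 𝓝 (1 : G × G), LCSmoothAt (E × E) 𝔷 (fun p : G × G => c.F p.1 p.2) p
  smooth_Θ : ∀ᶠ p in 𝓝 (1 : G × G × G),
    LCSmoothAt (E × E × E) EA (fun p : G × G × G => c.Θ p.1 p.2.1 p.2.2) p

/-- The derived map `L(F)(x, y) = T²F(x, y) - T²F(y, x)` on `L(G) = E`. -/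
def GenCocycle.derived (c : GenCocycle τ G) : E → E → 𝔷 :=
  antisymTaylor E 𝔷 (fun p : G × G => c.F p.1 p.2)

/-- `(F, Θ)` integrates the Lie algebra cocycle `ω` if `L(F)` is equivalent to `ω`. -/
def GenCocycle.Integrates (c : GenCocycle τ G) (ω : E → E → 𝔷) : Prop :=
  LieCocycleEquiv (lieAlgBracket E G) (c.derived E) ω

/-- The quotient map `𝔷 → 𝔷 / τ(A)`. -/
def quotMap (S : LieStructure 𝔷 (Multiplicative (𝔷 ⧸ τ.range))) : 𝔷 → S.Carrier :=
  fun x => Multiplicative.ofAdd (x : 𝔷 ⧸ τ.range)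

/-- The natural Lie group structure on `𝔷 / τ(A)` is the one for which the quotient map is a local
diffeomorphism. -/
def IsNaturalOnQuotient (S : LieStructure 𝔷 (Multiplicative (𝔷 ⧸ τ.range))) : Prop :=
  ∀ x : 𝔷, IsLCLocalDiffeoAt 𝔷 𝔷 (quotMap S) x

variable {E} {c : GenCocycle τ G}

/-- The map sending an object `(x, g)` of the 2-group of `c` to its isomorphism class. -/
def bandClassMap (T : LieStructure (𝔷 × E) (Band c)) : 𝔷 × G → T.Carrier :=
  fun p => bandClass c p

/-- The natural Lie group structure on the band is the one for which the map from the manifold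
`𝔷 × G` of objects to isomorphism classes is a local diffeomorphism at the unit object, i.e. for
which the smooth local section `g ↦ (0, g)` of the 2-group identifies `𝔷 / τ(A) × G` with the band
near the unit. -/
def IsNaturalOnBand (T : LieStructure (𝔷 × E) (Band c)) : Prop :=
  IsLCLocalDiffeoAt (𝔷 × E) (𝔷 × E) (bandClassMap T) (0, 1)

variable (S : LieStructure 𝔷 (Multiplicative (𝔷 ⧸ τ.range))) (T : LieStructure (𝔷 × E) (Band c))

/-- The inclusion of the band, as a homomorphism of Lie groups. -/
def bandInclLie : S.Carrier →* T.Carrier := bandIncl c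

/-- The projection of the band, as a homomorphism of Lie groups. -/
def bandProjLie : T.Carrier →* G := bandProj c

/-- The central extension `𝔷 / τ(A) → band → G` integrates `𝔷 → 𝔷 ⊕_ω 𝔤 → 𝔤`, where `𝔤 = L(G)`:
there is an isomorphism `Φ` of topological Lie algebras from `𝔷 ⊕_ω 𝔤` to the Lie algebra of the
band, compatible with the maps from `𝔷 ≅ L(𝔷 / τ(A))` and the maps to `𝔤`. Here `𝔷` is identified
with `L(𝔷 / τ(A))` by the differential of the quotient map. -/
def BandIntegrates (ω : E → E → 𝔷) : Prop :=
  ∃ Φ : (𝔷 × E) ≃L[ℝ] (𝔷 × E),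
    (∀ p q, Φ (extBracket (lieAlgBracket E G) ω p q) =
      lieAlgBracket (𝔷 × E) T.Carrier (Φ p) (Φ q)) ∧
    (∀ z, Φ (z, 0) = tangentAt 𝔷 (𝔷 × E) (bandInclLie S T) 1 (tangentAt 𝔷 𝔷 (quotMap S) 0 z)) ∧
    (∀ p, tangentAt (𝔷 × E) E (bandProjLie T) 1 (Φ p) = p.2)

end SmoothBand

/-! Passing to isomorphism classes kills exactly the morphisms, so `(x, g)` and `(y, h)` become
equal iff `g = h` and `y - x ∈ τ(A)` (`bandClass_eq_iff`). Modulo `τ(A)` the relation `dF = τ ∘ Θ`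
says that `F` is an ordinary group cocycle, and the band is the corresponding central extension of
`G` by `𝔷 / τ(A)`. Exactness and centrality are algebra; the work lies in the Lie group structure,
as `F` is smooth only near the unit.

Since `τ(A)` is discrete, some open `V ∋ 0` injects into `𝔷 / τ(A)`. Hence `V` times a chart domain
of `G` parametrises a subset of the band, and the product reads `(x + y + F(g, h), g h)`, which is
smooth near the unit. Such a local chart defines a Lie group, with left translates as atlas, as soon
as every conjugation is smooth near the unit (`LieChart.lieStructure`). The elements whose
conjugation is smooth in both directions form a subgroup containing the centre and a unit
neighbourhood. Because `G` is connected, the central kernel together with any unit neighbourhood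
generates the band, so this subgroup is everything (`LocalLieChart.exists_lieChart`,
`exists_lieChart_band`).

All structure maps are then explicit near the unit, and translations spread their smoothness. In
particular the identity between two natural structures is a homomorphism that is smooth at the unit,
which gives uniqueness. Translating the local section `g ↦ [(0, g)]` trivialises the bundle.

In the unit chart the multiplication is a linear map plus `F` in the first component and the
multiplication of `G` in the second. Its second order term is therefore `(T²F, T²m)`, and the
bracket of the band is `(L(F), [·,·])` (`lieAlgBracket_band`). If `L(F) = ω + b ∘ [·,·]`, the shear
`(z, x) ↦ (z + b x, x)` is the required isomorphism.

The calculus behind this is the chain rule, which rests on a mean value argument via Hahn–Banach. -/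

set_option linter.unusedSectionVars false

/-! ### Calculus on locally convex spaces: basic rules -/

section CalculusRules

variable {E F H : Type*} [AddCommGroup E] [Module ℝ E] [TopologicalSpace E]
  [AddCommGroup F] [Module ℝ F] [TopologicalSpace F]
  [AddCommGroup H] [Module ℝ H] [TopologicalSpace H]

theorem LCContDiffOn.continuousOn {n : ℕ} {U : Set E} {f : E → F} (hf : LCContDiffOn n U f) :
    ContinuousOn f U := by
  cases n with
  | zero => exact hf
  | succ n => exact hf.1

theorem LCSmoothOn.continuousOn {U : Set E} {f : E → F} (hf : LCSmoothOn U f) :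
    ContinuousOn f U := hf 0

/-- The space `E` is quantified after `n`, here and in the inductions below, because the derivative
of a map on `E` lives on `E × E`. -/
theorem LCContDiffOn.mono {n : ℕ} : ∀ {E : Type*} [AddCommGroup E] [Module ℝ E]
    [TopologicalSpace E] {U V : Set E} {f : E → F}, LCContDiffOn n V f → U ⊆ V →
    LCContDiffOn n U f := by
  induction n with
  | zero => intro E _ _ _ U V f hf h; exact ContinuousOn.mono hf h
  | succ n ih =>
    rintro E _ _ _ U V f ⟨hc, df, hd, hdf⟩ h
    exact ⟨hc.mono h, df, fun x hx => hd x (h hx), ih hdf (prod_mono h subset_rfl)⟩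

theorem LCSmoothOn.mono {U V : Set E} {f : E → F} (hf : LCSmoothOn V f) (h : U ⊆ V) :
    LCSmoothOn U f := fun n => (hf n).mono h

theorem LCContDiffOn.of_succ {n : ℕ} : ∀ {E : Type*} [AddCommGroup E] [Module ℝ E]
    [TopologicalSpace E] {U : Set E} {f : E → F}, LCContDiffOn (n + 1) U f →
    LCContDiffOn n U f := by
  induction n with
  | zero => intro E _ _ _ U f hf; exact hf.1
  | succ n ih =>
    rintro E _ _ _ U f ⟨hc, df, hd, hdf⟩
    exact ⟨hc, df, hd, ih hdf⟩

theorem LCContDiffOn.affine (n : ℕ) : ∀ {E : Type*} [AddCommGroup E] [Module ℝ E]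
    [TopologicalSpace E] (U : Set E) (L : E →L[ℝ] F) (c : F) [ContinuousAdd F],
    LCContDiffOn n U (fun x => L x + c) := by
  induction n with
  | zero => intro E _ _ _ U L c _; exact (L.continuous.add continuous_const).continuousOn
  | succ n ih =>
    intro E _ _ _ U L c _
    refine ⟨(L.continuous.add continuous_const).continuousOn,
      -- The summand `0` puts the derivative back into affine form, so that the induction hypothesis
      -- applies.
      fun p => (L.comp (ContinuousLinearMap.snd ℝ E E)) p + 0, fun x _ v => ?_, ih _ _ _⟩
    refine tendsto_const_nhds.congr' ?_
    filter_upwards [self_mem_nhdsWithin] with t (ht : t ≠ 0)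
    simp [smul_smul, ht]

theorem LCSmoothOn.affine (U : Set E) (L : E →L[ℝ] F) (c : F) [ContinuousAdd F] :
    LCSmoothOn U (fun x => L x + c) := fun n => LCContDiffOn.affine n U L c

theorem LCSmoothOn.const (U : Set E) (c : F) [ContinuousAdd F] :
    LCSmoothOn U (fun _ => c) := by
  simpa using LCSmoothOn.affine U (0 : E →L[ℝ] F) c

theorem LCSmoothOn.clm (U : Set E) (L : E →L[ℝ] F) [ContinuousAdd F] :
    LCSmoothOn U (fun x => L x) := by
  simpa using LCSmoothOn.affine U L 0

theorem LCSmoothOn.id (U : Set E) [ContinuousAdd E] : LCSmoothOn U (fun x : E => x) :=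
  LCSmoothOn.clm U (ContinuousLinearMap.id ℝ E)

theorem LCContDiffOn.comp_clm {n : ℕ} : ∀ {E : Type*} [AddCommGroup E] [Module ℝ E]
    [TopologicalSpace E] {H : Type*} [AddCommGroup H] [Module ℝ H]
    [TopologicalSpace H] {V : Set H} {f : H → F} (_ : LCContDiffOn n V f) (L : E →L[ℝ] H),
    LCContDiffOn n (L ⁻¹' V) (fun x => f (L x)) := by
  induction n with
  | zero =>
    intro E _ _ _ H _ _ _ V f hf L
    exact ContinuousOn.comp hf L.continuous.continuousOn (mapsTo_preimage _ _)
  | succ n ih =>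
    rintro E _ _ _ H _ _ _ V f ⟨hc, df, hd, hdf⟩ L
    refine ⟨hc.comp L.continuous.continuousOn (mapsTo_preimage _ _), fun p => df (L p.1, L p.2),
      fun x hx v => ?_, ?_⟩
    · simpa using hd (L x) hx (L v)
    · exact (ih hdf (L.prodMap L)).mono (fun p hp => ⟨hp.1, trivial⟩)

theorem LCContDiffOn.clm_comp {n : ℕ} [ContinuousAdd F] : ∀ {E : Type*} [AddCommGroup E]
    [Module ℝ E] [TopologicalSpace E] {U : Set E} {f : E → F} (_ : LCContDiffOn n U f)
    (L : F →L[ℝ] H), LCContDiffOn n U (fun x => L (f x)) := by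
  induction n with
  | zero =>
    intro E _ _ _ U f hf L
    exact L.continuous.comp_continuousOn hf
  | succ n ih =>
    rintro E _ _ _ U f ⟨hc, df, hd, hdf⟩ L
    refine ⟨L.continuous.comp_continuousOn hc, fun p => L (df p), fun x hx v => ?_, ih hdf L⟩
    refine ((L.continuous.tendsto _).comp (hd x hx v)).congr fun t => ?_
    simp

theorem LCSmoothOn.clm_comp [ContinuousAdd F] {U : Set E} {f : E → F} (hf : LCSmoothOn U f)
    (L : F →L[ℝ] H) : LCSmoothOn U (fun x => L (f x)) := fun n => (hf n).clm_comp L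

theorem LCContDiffOn.prodMk {n : ℕ} : ∀ {E : Type*} [AddCommGroup E]
    [Module ℝ E] [TopologicalSpace E] {U : Set E} {f : E → F} {g : E → H}
    (_ : LCContDiffOn n U f) (_ : LCContDiffOn n U g),
    LCContDiffOn n U (fun x => (f x, g x)) := by
  induction n with
  | zero =>
    intro E _ _ _ U f g hf hg
    exact ContinuousOn.prodMk hf hg
  | succ n ih =>
    rintro E _ _ _ U f g ⟨hc, df, hd, hdf⟩ ⟨hc', dg, hd', hdg⟩
    exact ⟨hc.prodMk hc', fun p => (df p, dg p),
      fun x hx v => (hd x hx v).prodMk_nhds (hd' x hx v), ih hdf hdg⟩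

theorem LCSmoothOn.prodMk {U : Set E} {f : E → F} {g : E → H} (hf : LCSmoothOn U f)
    (hg : LCSmoothOn U g) : LCSmoothOn U (fun x => (f x, g x)) :=
  fun n => (hf n).prodMk (hg n)

theorem tendsto_add_smul_nhds [ContinuousAdd E] [ContinuousSMul ℝ E] (x v : E) :
    Tendsto (fun t : ℝ => x + t • v) (𝓝[≠] 0) (𝓝 x) := by
  have h : Continuous (fun t : ℝ => x + t • v) := by fun_prop
  simpa using (h.tendsto 0).mono_left nhdsWithin_le_nhds

/-- No induction is needed: `U` is open, so small difference quotients see only points of `U`, and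
the same derivative serves both maps. -/
theorem LCContDiffOn.congr [ContinuousAdd E] [ContinuousSMul ℝ E] {n : ℕ} {U : Set E}
    {f g : E → F} (hU : IsOpen U) (hf : LCContDiffOn n U f) (h : EqOn g f U) :
    LCContDiffOn n U g := by
  cases n with
  | zero => exact ContinuousOn.congr hf h
  | succ n =>
    obtain ⟨hc, df, hd, hdf⟩ := hf
    refine ⟨hc.congr h, df, fun x hx v => (hd x hx v).congr' ?_, hdf⟩
    filter_upwards [tendsto_add_smul_nhds x v (hU.mem_nhds hx)] with t ht
    rw [h ht, h hx]

theorem LCSmoothOn.congr [ContinuousAdd E] [ContinuousSMul ℝ E] {U : Set E}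
    {f g : E → F} (hf : LCSmoothOn U f) (hU : IsOpen U) (h : EqOn g f U) :
    LCSmoothOn U g := fun n => (hf n).congr hU h

/-- A map with continuous directional derivatives is strictly differentiable. -/
theorem tendsto_quotient_of_continuousOn_derivative [IsTopologicalAddGroup E] [ContinuousSMul ℝ E]
    [IsTopologicalAddGroup F] [ContinuousSMul ℝ F] [LocallyConvexSpace ℝ F]
    {U : Set E} (hU : IsOpen U) {f : E → F} {df : E × E → F}
    (hd : ∀ x ∈ U, ∀ v : E, Tendsto (fun t : ℝ => t⁻¹ • (f (x + t • v) - f x)) (𝓝[≠] 0)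
        (𝓝 (df (x, v))))
    (hdf : ContinuousOn df (U ×ˢ (univ : Set E))) {x : E} (hx : x ∈ U) (w : E) :
    Tendsto (fun q : ℝ × E × E => q.1⁻¹ • (f (q.2.1 + q.1 • q.2.2) - f q.2.1))
      (𝓝[≠] 0 ×ˢ 𝓝 x ×ˢ 𝓝 w) (𝓝 (df (x, w))) := by
  intro O hO
  have hO' : (fun z => df (x, w) + z) ⁻¹' O ∈ 𝓝 (0 : F) := by
    apply (continuous_const.add continuous_id).continuousAt.preimage_mem_nhds
    simpa using hO
  obtain ⟨C, ⟨hC0, hCcl⟩, hCO⟩ := (closed_nhds_basis (0 : F)).mem_iff.1 hO'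
  obtain ⟨K, ⟨hK0, hKc⟩, hKC⟩ := (LocallyConvexSpace.convex_basis_zero ℝ F).mem_iff.1 hC0
  -- It now suffices to place the difference quotient, up to the shift by `df (x, w)`, in the
  -- closure of the convex set `K`.
  have hKC' : closure K ⊆ C := closure_minimal hKC hCcl
  have hnear : {p : E × E | p.1 ∈ U ∧ df p - df (x, w) ∈ K} ∈ 𝓝 (x, w) := by
    have h1 : U ×ˢ (univ : Set E) ∈ 𝓝 (x, w) := (hU.prod isOpen_univ).mem_nhds ⟨hx, trivial⟩
    have h2 : ContinuousAt (fun p => df p - df (x, w)) (x, w) :=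
      (hdf.continuousAt h1).sub continuousAt_const
    have h3 := h2.preimage_mem_nhds (t := K) (by simpa using hK0)
    filter_upwards [h1, h3] with p hp hp' using ⟨hp.1, hp'⟩
  -- Compactness of `[0, 1]` gives one neighbourhood that works for all points of the segment from
  -- `y` to `y + t u`.
  have hev : ∀ᶠ q : ℝ × E × E in 𝓝 (0, x, w), ∀ s ∈ Icc (0 : ℝ) 1,
      (q.2.1 + (s * q.1) • q.2.2) ∈ U ∧
        df (q.2.1 + (s * q.1) • q.2.2, q.2.2) - df (x, w) ∈ K := by
    apply isCompact_Icc.eventually_forall_of_forall_eventually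
    intro s _
    have hc : Continuous (fun z : (ℝ × E × E) × ℝ =>
        (z.1.2.1 + (z.2 * z.1.1) • z.1.2.2, z.1.2.2)) := by fun_prop
    have := hc.tendsto ((0, x, w), s)
    simp only [mul_zero, zero_smul, add_zero] at this
    exact this hnear
  have hle : (𝓝[≠] (0 : ℝ) ×ˢ 𝓝 x ×ˢ 𝓝 w) ≤ 𝓝 (0, x, w) := by
    rw [nhds_prod_eq, nhds_prod_eq]
    exact Filter.prod_mono nhdsWithin_le_nhds le_rfl
  have hne : ∀ᶠ q : ℝ × E × E in (𝓝[≠] (0 : ℝ) ×ˢ 𝓝 x ×ˢ 𝓝 w), q.1 ≠ 0 :=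
    tendsto_fst.eventually (self_mem_nhdsWithin : {t : ℝ | t ≠ 0} ∈ 𝓝[≠] (0 : ℝ))
  rw [mem_map]
  filter_upwards [hle hev, hne] with q hq hq0
  obtain ⟨t, y, u⟩ := q
  simp only [mem_preimage] at *
  set z := t⁻¹ • (f (y + t • u) - f y) with hz
  suffices h : z - df (x, w) ∈ closure K by
    have := hCO (hKC' h)
    simpa using this
  by_contra hcon
  -- A functional `l` separating the difference quotient from `closure K` contradicts the
  -- one-variable mean value theorem for `s ↦ l (f (y + s t u))`: by that theorem `l` takes the same
  -- value on the quotient as on some derivative along the segment, and these derivatives lie in the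
  -- shifted `K`.
  obtain ⟨l, a, hla, haz⟩ := geometric_hahn_banach_closed_point hKc.closure isClosed_closure hcon
  have hder : ∀ s ∈ Icc (0 : ℝ) 1, HasDerivAt (fun s : ℝ => l (f (y + (s * t) • u)))
      (l (df (y + (s * t) • u, u)) * t) s := by
    intro s hs
    have h1 : HasDerivAt (fun r : ℝ => l (f (y + r • u))) (l (df (y + (s * t) • u, u))) (s * t) := by
      rw [hasDerivAt_iff_tendsto_slope_zero]
      refine ((l.continuous.tendsto _).comp (hd _ (hq s hs).1 u)).congr fun r => ?_
      simp [add_smul, add_assoc]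
    have h2 : HasDerivAt (fun s : ℝ => s * t) t s := by simpa using (hasDerivAt_id s).mul_const t
    exact h1.comp s h2
  obtain ⟨s, hs, hseq⟩ := exists_hasDerivAt_eq_slope (fun s : ℝ => l (f (y + (s * t) • u)))
    (fun s => l (df (y + (s * t) • u, u)) * t) zero_lt_one
    (fun s hs => (hder s hs).continuousAt.continuousWithinAt)
    (fun s hs => hder s (Ioo_subset_Icc_self hs))
  have hs' := hla _ (subset_closure (hq s (Ioo_subset_Icc_self hs)).2)
  simp only [one_mul, zero_mul, zero_smul, add_zero, sub_zero, div_one] at hseq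
  have hlz : l z = l (df (y + (s * t) • u, u)) := by
    rw [hz, map_smul, map_sub, ← hseq, smul_eq_mul]
    field_simp
  rw [map_sub, hlz, ← map_sub] at haz
  exact lt_asymm haz hs'

/-- Write `g (x + t v) = g x + t u_t` with `u_t → dg (x, v)`. The direction `u_t` varies with `t`,
so directional derivatives of `f` alone do not suffice; strict differentiability does. The
derivative `(x, v) ↦ df (g x, dg (x, v))` is again a composition, to which induction applies. -/
theorem LCContDiffOn.comp {n : ℕ} [IsTopologicalAddGroup F] [ContinuousSMul ℝ F]
    [LocallyConvexSpace ℝ F] : ∀ {E : Type*} [AddCommGroup E]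
    [Module ℝ E] [TopologicalSpace E] [IsTopologicalAddGroup E] [ContinuousSMul ℝ E]
    {H : Type*} [AddCommGroup H] [Module ℝ H] [TopologicalSpace H] [IsTopologicalAddGroup H]
    [ContinuousSMul ℝ H] {U : Set E} {V : Set H} {f : H → F} {g : E → H}
    (_ : LCContDiffOn n V f) (_ : LCContDiffOn n U g) (_ : IsOpen U) (_ : IsOpen V)
    (_ : MapsTo g U V), LCContDiffOn n U (fun x => f (g x)) := by
  induction n with
  | zero =>
    intro E _ _ _ _ _ H _ _ _ _ _ U V f g hf hg _ _ h
    exact ContinuousOn.comp hf hg h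
  | succ n ih =>
    intro E _ _ _ _ _ H _ _ _ _ _ U V f g hf hg hU hV h
    have hg' := hg.of_succ
    obtain ⟨hc, df, hd, hdf⟩ := hf
    obtain ⟨hc', dg, hd', hdg⟩ := hg
    refine ⟨hc.comp hc' h, fun p => df (g p.1, dg p), fun x hx v => ?_, ?_⟩
    · have h1 := tendsto_quotient_of_continuousOn_derivative hV hd hdf.continuousOn (h hx)
        (dg (x, v))
      have h2 : Tendsto (fun t : ℝ => (t, g x, t⁻¹ • (g (x + t • v) - g x))) (𝓝[≠] 0)
          (𝓝[≠] 0 ×ˢ 𝓝 (g x) ×ˢ 𝓝 (dg (x, v))) :=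
        tendsto_id.prodMk (tendsto_const_nhds.prodMk (hd' x hx v))
      refine (h1.comp h2).congr' ?_
      filter_upwards [self_mem_nhdsWithin] with t (ht : t ≠ 0)
      simp [smul_smul, ht]
    · have hfst : LCContDiffOn n (U ×ˢ (univ : Set E)) (fun p => g p.1) :=
        (hg'.comp_clm (ContinuousLinearMap.fst ℝ E E)).mono fun p hp => hp.1
      exact ih hdf (hfst.prodMk hdg) (hU.prod isOpen_univ) (hV.prod isOpen_univ)
        fun p hp => ⟨h hp.1, trivial⟩

theorem LCSmoothOn.comp [IsTopologicalAddGroup F] [ContinuousSMul ℝ F]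
    [LocallyConvexSpace ℝ F] [IsTopologicalAddGroup E] [ContinuousSMul ℝ E]
    [IsTopologicalAddGroup H] [ContinuousSMul ℝ H] {U : Set E} {V : Set H} {f : H → F} {g : E → H}
    (hf : LCSmoothOn V f) (hg : LCSmoothOn U g) (hU : IsOpen U) (hV : IsOpen V)
    (h : MapsTo g U V) : LCSmoothOn U (fun x => f (g x)) :=
  fun n => (hf n).comp (hg n) hU hV h

theorem LCSmoothOn.add [IsTopologicalAddGroup F] [ContinuousSMul ℝ F]
    {U : Set E} {f g : E → F} (hf : LCSmoothOn U f) (hg : LCSmoothOn U g) :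
    LCSmoothOn U (fun x => f x + g x) :=
  (hf.prodMk hg).clm_comp (ContinuousLinearMap.fst ℝ F F + ContinuousLinearMap.snd ℝ F F)

theorem LCSmoothOn.neg [IsTopologicalAddGroup F] [ContinuousSMul ℝ F]
    {U : Set E} {f : E → F} (hf : LCSmoothOn U f) :
    LCSmoothOn U (fun x => - f x) :=
  hf.clm_comp (-ContinuousLinearMap.id ℝ F)

/-! ### Directional derivatives -/

theorem dirDeriv_eq [T2Space F] {f : E → F} {x v : E} {y : F}
    (h : Tendsto (fun t : ℝ => t⁻¹ • (f (x + t • v) - f x)) (𝓝[≠] 0) (𝓝 y)) :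
    dirDeriv f x v = y := h.limUnder_eq

theorem dirDeriv_congr [ContinuousAdd E] [ContinuousSMul ℝ E] {f g : E → F} {x : E}
    (h : f =ᶠ[𝓝 x] g) (v : E) : dirDeriv f x v = dirDeriv g x v := by
  unfold dirDeriv limUnder
  congr 1
  apply Filter.map_congr
  filter_upwards [tendsto_add_smul_nhds x v h] with t ht
  have ht' : f (x + t • v) = g (x + t • v) := ht
  rw [ht', h.self_of_nhds]

theorem LCContDiffOn.tendsto_dirDeriv [T2Space F] {n : ℕ} {U : Set E} {f : E → F}
    (hf : LCContDiffOn (n + 1) U f) {x : E} (hx : x ∈ U) (v : E) :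
    Tendsto (fun t : ℝ => t⁻¹ • (f (x + t • v) - f x)) (𝓝[≠] 0) (𝓝 (dirDeriv f x v)) := by
  obtain ⟨-, df, hd, -⟩ := hf
  rw [dirDeriv_eq (hd x hx v)]
  exact hd x hx v

theorem LCSmoothOn.tendsto_dirDeriv [T2Space F] {U : Set E} {f : E → F}
    (hf : LCSmoothOn U f) {x : E} (hx : x ∈ U) (v : E) :
    Tendsto (fun t : ℝ => t⁻¹ • (f (x + t • v) - f x)) (𝓝[≠] 0) (𝓝 (dirDeriv f x v)) :=
  (hf 1).tendsto_dirDeriv hx v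

theorem LCSmoothOn.dirDeriv [T2Space F] [IsTopologicalAddGroup E] [ContinuousSMul ℝ E]
    [IsTopologicalAddGroup F] [ContinuousSMul ℝ F] [LocallyConvexSpace ℝ F]
    {U : Set E} {f : E → F} (hU : IsOpen U) (hf : LCSmoothOn U f) (v : E) :
    LCSmoothOn U (fun x => dirDeriv f x v) := by
  intro n
  obtain ⟨-, df, hd, hdf⟩ := hf (n + 1)
  have h : LCContDiffOn n U (fun x => df (x, v)) :=
    hdf.comp (LCContDiffOn.prodMk (LCSmoothOn.id U n) (LCSmoothOn.const U v n)) hU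
      (hU.prod isOpen_univ) fun x hx => ⟨hx, trivial⟩
  exact h.congr hU fun x hx => dirDeriv_eq (hd x hx v)

theorem LCSmoothOn.dirDeriv_prodMk [T2Space F] [T2Space H] {U : Set E} {f : E → F} {g : E → H}
    (hf : LCSmoothOn U f) (hg : LCSmoothOn U g) {x : E} (hx : x ∈ U) (v : E) :
    _root_.dirDeriv (fun x => (f x, g x)) x v =
      (_root_.dirDeriv f x v, _root_.dirDeriv g x v) :=
  dirDeriv_eq ((hf.tendsto_dirDeriv hx v).prodMk_nhds (hg.tendsto_dirDeriv hx v))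

theorem dirDeriv_affine_add [T2Space F] [IsTopologicalAddGroup F] [ContinuousSMul ℝ F]
    (L : E →L[ℝ] F) (c : F) {U : Set E} {f : E → F}
    (hf : LCSmoothOn U f) {x : E} (hx : x ∈ U) (v : E) :
    dirDeriv (fun x => L x + c + f x) x v = L v + dirDeriv f x v := by
  apply dirDeriv_eq
  refine ((tendsto_const_nhds (x := L v)).add (hf.tendsto_dirDeriv hx v)).congr' ?_
  filter_upwards [self_mem_nhdsWithin] with t (ht : t ≠ 0)
  have h1 : L v = t⁻¹ • (t • L v) := by rw [smul_smul, inv_mul_cancel₀ ht, one_smul]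
  conv_lhs => rw [h1]
  rw [← smul_add, map_add, map_smul]
  congr 1
  abel

theorem dirDeriv_affine [T2Space F] [IsTopologicalAddGroup F] [ContinuousSMul ℝ F]
    (L : E →L[ℝ] F) (c : F) (x v : E) : dirDeriv (fun x => L x + c) x v = L v := by
  have h := dirDeriv_affine_add L c (LCSmoothOn.const (univ : Set E) (0 : F)) (mem_univ x) v
  simp only [add_zero] at h
  rw [h, dirDeriv_eq (y := (0 : F)) (by simp), add_zero]

theorem dirDeriv_comp_clm (f : H → F) (L : E →L[ℝ] H) (x v : E) :
    dirDeriv (fun x => f (L x)) x v = dirDeriv f (L x) (L v) := by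
  simp [dirDeriv]

end CalculusRules

/-! ### Smooth maps between manifolds -/

section SmoothMaps

variable {E E' E'' : Type*}
  [AddCommGroup E] [Module ℝ E] [TopologicalSpace E] [IsTopologicalAddGroup E]
  [ContinuousSMul ℝ E]
  [AddCommGroup E'] [Module ℝ E'] [TopologicalSpace E'] [IsTopologicalAddGroup E']
  [ContinuousSMul ℝ E']
  [AddCommGroup E''] [Module ℝ E''] [TopologicalSpace E''] [IsTopologicalAddGroup E'']
  [ContinuousSMul ℝ E'']
  {M N P : Type*} [TopologicalSpace M] [TopologicalSpace N] [TopologicalSpace P]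

/-- The expression of `f` in the charts `e` and `e'` is defined and smooth on a neighbourhood
of `x`. -/
def SmoothInCharts (e : OpenPartialHomeomorph M E) (e' : OpenPartialHomeomorph N E')
    (f : M → N) (x : E) : Prop :=
  ∃ W : Set E, IsOpen W ∧ x ∈ W ∧ W ⊆ e.target ∧ (∀ y ∈ W, f (e.symm y) ∈ e'.source) ∧
    LCSmoothOn W (e' ∘ f ∘ e.symm)

theorem SmoothInCharts.continuousAt {e : OpenPartialHomeomorph M E}
    {e' : OpenPartialHomeomorph N E'} {f : M → N} {p : M} (hp : p ∈ e.source)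
    (h : SmoothInCharts e e' f (e p)) : ContinuousAt f p := by
  obtain ⟨W, hW, hpW, hWt, hWs, hsm⟩ := h
  have h1 : ContinuousAt (fun m => e'.symm ((e' ∘ f ∘ e.symm) (e m))) p := by
    have h2 : ContinuousAt (e' ∘ f ∘ e.symm) (e p) :=
      hsm.continuousOn.continuousAt (hW.mem_nhds hpW)
    have h3 : ContinuousAt e'.symm ((e' ∘ f ∘ e.symm) (e p)) :=
      e'.continuousAt_symm (e'.map_source (hWs _ hpW))
    exact ContinuousAt.comp (f := fun m => (e' ∘ f ∘ e.symm) (e m)) (x := p) h3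
      (ContinuousAt.comp (f := e) h2 (e.continuousAt hp))
  refine h1.congr ?_
  have h4 : ∀ᶠ m in 𝓝 p, e m ∈ W := (e.continuousAt hp).preimage_mem_nhds (hW.mem_nhds hpW)
  filter_upwards [h4, e.open_source.mem_nhds hp] with m hm hms
  have := e'.left_inv (hWs _ hm)
  simpa [e.left_inv hms] using this

variable [ChartedSpace E M] [ChartedSpace E' N] [ChartedSpace E'' P]

/-- Continuity at `p` lets the domain shrink until `f` maps it into the chart at `f p`; conversely,
this mapping condition makes `f` continuous at `p`. The right-hand form is the one that composes. -/
theorem lcSmoothAt_iff {f : M → N} {p : M} :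
    LCSmoothAt E E' f p ↔ SmoothInCharts (chartAt E p) (chartAt E' (f p)) f (chartAt E p p) := by
  constructor
  · rintro ⟨hc, W, hW, hpW, hWt, hsm⟩
    have h1 : f ⁻¹' (chartAt E' (f p)).source ∈ 𝓝 p :=
      hc.preimage_mem_nhds ((chartAt E' (f p)).open_source.mem_nhds (mem_chart_source E' (f p)))
    have h2 := (chartAt E p).symm.continuousAt (x := chartAt E p p)
      ((chartAt E p).map_source (mem_chart_source E p))
    rw [← (chartAt E p).left_inv (mem_chart_source E p)] at h1
    obtain ⟨V, hV, hVo, hpV⟩ := mem_nhds_iff.1 (h2.preimage_mem_nhds h1)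
    refine ⟨W ∩ V, hW.inter hVo, ⟨hpW, hpV⟩, fun y hy => hWt hy.1, fun y hy => ?_,
      hsm.mono inter_subset_left⟩
    have := hV hy.2
    rwa [(chartAt E p).left_inv (mem_chart_source E p)] at this
  · intro h
    refine ⟨h.continuousAt (mem_chart_source E p), ?_⟩
    obtain ⟨W, hW, hpW, hWt, -, hsm⟩ := h
    exact ⟨W, hW, hpW, hWt, hsm⟩

theorem SmoothInCharts.comp [LocallyConvexSpace ℝ E''] {e : OpenPartialHomeomorph M E}
    {e' : OpenPartialHomeomorph N E'} {e'' : OpenPartialHomeomorph P E''} {f : M → N} {g : N → P}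
    {x : E} (hg : SmoothInCharts e' e'' g (e' (f (e.symm x)))) (hf : SmoothInCharts e e' f x) :
    SmoothInCharts e e'' (g ∘ f) x := by
  obtain ⟨W, hW, hpW, hWt, hWs, hsm⟩ := hf
  obtain ⟨V, hV, hpV, hVt, hVs, hsm'⟩ := hg
  have heq : ∀ y ∈ W, e'.symm (e' (f (e.symm y))) = f (e.symm y) :=
    fun y hy => e'.left_inv (hWs y hy)
  have ho := hsm.continuousOn.isOpen_inter_preimage hW hV
  refine ⟨_, ho, ⟨hpW, hpV⟩, fun y hy => hWt hy.1, fun y hy => ?_, ?_⟩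
  · have := hVs _ hy.2
    simp only [Function.comp_apply, heq y hy.1] at this
    exact this
  · refine (hsm'.comp (hsm.mono inter_subset_left) ho hV fun y hy => hy.2).congr ho fun y hy => ?_
    simp [heq y hy.1]

theorem LCSmoothAt.comp [LocallyConvexSpace ℝ E''] {f : M → N} {g : N → P} {p : M}
    (hg : LCSmoothAt E' E'' g (f p)) (hf : LCSmoothAt E E' f p) :
    LCSmoothAt E E'' (fun x => g (f x)) p := by
  rw [lcSmoothAt_iff] at *
  refine SmoothInCharts.comp ?_ hf
  rwa [(chartAt E p).left_inv (mem_chart_source E p)]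

theorem LCSmoothAt.congr {f g : M → N} {p : M} (hf : LCSmoothAt E E' f p) (h : f =ᶠ[𝓝 p] g) :
    LCSmoothAt E E' g p := by
  rw [lcSmoothAt_iff] at *
  rw [← h.self_of_nhds]
  obtain ⟨W, hW, hpW, hWt, hWs, hsm⟩ := hf
  have h2 := (chartAt E p).symm.continuousAt (x := chartAt E p p)
      ((chartAt E p).map_source (mem_chart_source E p))
  have h1 : {m | f m = g m} ∈ 𝓝 p := h
  rw [← (chartAt E p).left_inv (mem_chart_source E p)] at h1
  obtain ⟨V, hV, hVo, hpV⟩ := mem_nhds_iff.1 (h2.preimage_mem_nhds h1)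
  have hVe : ∀ y ∈ V, f ((chartAt E p).symm y) = g ((chartAt E p).symm y) := fun y hy => hV hy
  refine ⟨W ∩ V, hW.inter hVo, ⟨hpW, hpV⟩, fun y hy => hWt hy.1, fun y hy => ?_,
    (hsm.mono inter_subset_left).congr (hW.inter hVo) fun y hy => ?_⟩
  · rw [← hVe y hy.2]; exact hWs y hy.1
  · simp [hVe y hy.2]

theorem LCSmoothAt.id (p : M) : LCSmoothAt E E (fun x : M => x) p := by
  rw [lcSmoothAt_iff]
  refine ⟨_, (chartAt E p).open_target, (chartAt E p).map_source (mem_chart_source E p), subset_rfl,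
    fun y hy => (chartAt E p).map_target hy, ?_⟩
  refine (LCSmoothOn.id _).congr (chartAt E p).open_target fun y hy => ?_
  simp [(chartAt E p).right_inv hy]

theorem LCSmoothAt.const (q : N) (p : M) : LCSmoothAt E E' (fun _ : M => q) p := by
  rw [lcSmoothAt_iff]
  exact ⟨_, (chartAt E p).open_target, (chartAt E p).map_source (mem_chart_source E p), subset_rfl,
    fun y hy => mem_chart_source E' q, LCSmoothOn.const _ (chartAt E' q q)⟩

theorem LCSmoothAt.prodMk {f : M → N} {g : M → P} {p : M} (hf : LCSmoothAt E E' f p)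
    (hg : LCSmoothAt E E'' g p) : LCSmoothAt E (E' × E'') (fun x => (f x, g x)) p := by
  rw [lcSmoothAt_iff] at *
  obtain ⟨W, hW, hpW, hWt, hWs, hsm⟩ := hf
  obtain ⟨V, hV, hpV, hVt, hVs, hsm'⟩ := hg
  exact ⟨W ∩ V, hW.inter hV, ⟨hpW, hpV⟩, fun y hy => hWt hy.1,
    fun y hy => ⟨hWs y hy.1, hVs y hy.2⟩,
    (hsm.mono inter_subset_left).prodMk (hsm'.mono inter_subset_right)⟩

theorem lcSmoothAt_fst (p : M × N) : LCSmoothAt (E × E') E (fun x : M × N => x.1) p := by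
  rw [lcSmoothAt_iff]
  refine ⟨_, (chartAt (E × E') p).open_target,
    (chartAt (E × E') p).map_source (mem_chart_source _ p), subset_rfl,
    fun y hy => (chartAt E p.1).map_target hy.1, ?_⟩
  refine (LCSmoothOn.clm _ (ContinuousLinearMap.fst ℝ E E')).congr
    (chartAt (E × E') p).open_target fun y hy => ?_
  exact (chartAt E p.1).right_inv hy.1

theorem lcSmoothAt_snd (p : M × N) : LCSmoothAt (E × E') E' (fun x : M × N => x.2) p := by
  rw [lcSmoothAt_iff]
  refine ⟨_, (chartAt (E × E') p).open_target,
    (chartAt (E × E') p).map_source (mem_chart_source _ p), subset_rfl,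
    fun y hy => (chartAt E' p.2).map_target hy.2, ?_⟩
  refine (LCSmoothOn.clm _ (ContinuousLinearMap.snd ℝ E E')).congr
    (chartAt (E × E') p).open_target fun y hy => ?_
  exact (chartAt E' p.2).right_inv hy.2

theorem LCSmoothOn.lcSmoothAt {U : Set E} {f : E → E'} (hf : LCSmoothOn U f) (hU : IsOpen U)
    {x : E} (hx : x ∈ U) : LCSmoothAt E E' f x := by
  rw [lcSmoothAt_iff]
  exact ⟨U, hU, hx, subset_univ _, fun _ _ => trivial, hf⟩

instance lcManifoldSelf [T2Space E] : LCManifold E E where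
  t2 := inferInstance
  smooth_coordChange e he e' he' := by
    rw [chartedSpaceSelf_atlas] at he he'
    subst he; subst he'
    exact LCSmoothOn.id _

/-- A coordinate change is the identity map read in two charts, so this is composition with the
identity on both sides. -/
theorem SmoothInCharts.change_charts [LocallyConvexSpace ℝ E] [LocallyConvexSpace ℝ E']
    [LCManifold E M] [LCManifold E' N] {e e₁ : OpenPartialHomeomorph M E}
    {e' e₁' : OpenPartialHomeomorph N E'} (he : e ∈ atlas E M) (he₁ : e₁ ∈ atlas E M)
    (he' : e' ∈ atlas E' N) (he₁' : e₁' ∈ atlas E' N) {f : M → N} {p : M} (hp : p ∈ e.source)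
    (hp₁ : p ∈ e₁.source) (hfp : f p ∈ e₁'.source) (h : SmoothInCharts e e' f (e p)) :
    SmoothInCharts e₁ e₁' f (e₁ p) := by
  obtain ⟨W, hW, hpW, hWt, hWs, hsm⟩ := h
  have hfp' : f p ∈ e'.source := by simpa [e.left_inv hp] using hWs _ hpW
  have h1 : SmoothInCharts e₁ e (fun x : M => x) (e₁ p) :=
    ⟨_, (e₁.symm.trans e).open_source, by simp [hp₁, e₁.left_inv hp₁, hp], fun y hy => hy.1,
      fun y hy => hy.2, LCManifold.smooth_coordChange _ he₁ _ he⟩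
  have h2 : SmoothInCharts e' e₁' (fun x : N => x) (e' (f p)) :=
    ⟨_, (e'.symm.trans e₁').open_source, by simp [hfp', e'.left_inv hfp', hfp], fun y hy => hy.1,
      fun y hy => hy.2, LCManifold.smooth_coordChange _ he' _ he₁'⟩
  have h3 : SmoothInCharts e₁ e' f (e₁ p) :=
    SmoothInCharts.comp (f := fun x : M => x)
      (by rw [e₁.left_inv hp₁]; exact ⟨W, hW, hpW, hWt, hWs, hsm⟩) h1
  exact SmoothInCharts.comp (g := fun x : N => x) (by rwa [e₁.left_inv hp₁]) h3

/-- Smoothness near a point is an open condition. -/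
theorem LCSmoothAt.eventually [LocallyConvexSpace ℝ E] [LocallyConvexSpace ℝ E']
    [LCManifold E M] [LCManifold E' N] {f : M → N} {p : M} (hf : LCSmoothAt E E' f p) :
    ∀ᶠ q in 𝓝 p, LCSmoothAt E E' f q := by
  obtain ⟨W, hW, hpW, hWt, hWs, hsm⟩ := lcSmoothAt_iff.1 hf
  have h4 : ∀ᶠ m in 𝓝 p, chartAt E p m ∈ W :=
    ((chartAt E p).continuousAt (mem_chart_source E p)).preimage_mem_nhds (hW.mem_nhds hpW)
  filter_upwards [h4, (chartAt E p).open_source.mem_nhds (mem_chart_source E p)] with q hq hqs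
  rw [lcSmoothAt_iff]
  exact SmoothInCharts.change_charts (chart_mem_atlas E p) (chart_mem_atlas E q)
    (chart_mem_atlas E' (f p)) (chart_mem_atlas E' (f q)) hqs (mem_chart_source E q)
    (mem_chart_source E' (f q)) ⟨W, hW, hq, hWt, hWs, hsm⟩

/-- A map which is smooth near `p` and has a two-sided local inverse which is smooth near `f p` is
a local diffeomorphism at `p`. -/
theorem isLCLocalDiffeoAt_of_local_inverse {f : M → N} {j : N → M} {p : M}
    (hf : ∀ᶠ x in 𝓝 p, LCSmoothAt E E' f x) (hj : ∀ᶠ y in 𝓝 (f p), LCSmoothAt E' E j y)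
    (hjf : ∀ᶠ x in 𝓝 p, j (f x) = x) (hfj : ∀ᶠ y in 𝓝 (f p), f (j y) = y) :
    IsLCLocalDiffeoAt E E' f p := by
  obtain ⟨A, hA, hAo, hpA⟩ := eventually_nhds_iff.1 (hf.and hjf)
  obtain ⟨B, hB, hBo, hpB⟩ := eventually_nhds_iff.1 (hj.and hfj)
  have hfc : ContinuousOn f A := fun x hx => (hA x hx).1.1.continuousWithinAt
  have hjc : ContinuousOn j B := fun y hy => (hB y hy).1.1.continuousWithinAt
  refine ⟨A ∩ f ⁻¹' B, B ∩ j ⁻¹' A, ⟨hpA, hpB⟩, hfc.isOpen_inter_preimage hAo hBo,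
    hjc.isOpen_inter_preimage hBo hAo, j, fun x hx => ⟨hx.2, ?_⟩, fun y hy => ⟨hy.2, ?_⟩,
    fun x hx => (hA x hx.1).2, fun y hy => (hB y hy.1).2, fun x hx => (hA x hx.1).1,
    fun y hy => (hB y hy.1).1⟩
  · rw [mem_preimage, (hA x hx.1).2]; exact hx.1
  · rw [mem_preimage, (hB y hy.1).2]; exact hy.1

/-- A local inverse of a local diffeomorphism. -/
theorem IsLCLocalDiffeoAt.exists_local_inverse {f : M → N} {p : M}
    (hf : IsLCLocalDiffeoAt E E' f p) : LCSmoothAt E E' f p ∧ ∃ j : N → M,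
      LCSmoothAt E' E j (f p) ∧ j (f p) = p ∧ ∀ᶠ y in 𝓝 (f p), f (j y) = y := by
  obtain ⟨U, V, hp, hU, hV, j, hfU, hj, hl, hr, hsf, hsj⟩ := hf
  exact ⟨hsf p hp, j, hsj _ (hfU hp), hl hp,
    eventually_of_mem (hV.mem_nhds (hfU hp)) fun y hy => hr hy⟩

end SmoothMaps

/-! ### Smooth maps into Lie groups and smooth homomorphisms -/

section LieGroups

variable {E E' E'' : Type*}
  [AddCommGroup E] [Module ℝ E] [TopologicalSpace E] [IsTopologicalAddGroup E]
  [ContinuousSMul ℝ E] [LocallyConvexSpace ℝ E]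
  [AddCommGroup E'] [Module ℝ E'] [TopologicalSpace E'] [IsTopologicalAddGroup E']
  [ContinuousSMul ℝ E'] [LocallyConvexSpace ℝ E']
  {M G H : Type*} [TopologicalSpace M] [ChartedSpace E' M]
  [Group G] [TopologicalSpace G] [ChartedSpace E G] [LCLieGroup E G]
  [Group H] [TopologicalSpace H] [ChartedSpace E' H] [LCLieGroup E' H]

theorem LCSmoothAt.mul {f g : M → G} {p : M} (hf : LCSmoothAt E' E f p)
    (hg : LCSmoothAt E' E g p) : LCSmoothAt E' E (fun x => f x * g x) p :=
  LCSmoothAt.comp (f := fun x => (f x, g x)) (g := fun q : G × G => q.1 * q.2) (LCLieGroup.smooth_mul (E := E) (f p, g p))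
    (hf.prodMk hg)

theorem LCSmoothAt.inv {f : M → G} {p : M} (hf : LCSmoothAt E' E f p) :
    LCSmoothAt E' E (fun x => (f x)⁻¹) p :=
  LCSmoothAt.comp (g := fun q : G => q⁻¹) (LCLieGroup.smooth_inv (E := E) (f p)) hf

theorem LCSmoothAt.const_mul (a : G) {f : M → G} {p : M} (hf : LCSmoothAt E' E f p) :
    LCSmoothAt E' E (fun x => a * f x) p := (LCSmoothAt.const a p).mul hf

/-- A homomorphism of Lie groups which is smooth near the unit is smooth. -/
theorem LCSmooth.of_hom (f : G →* H) (hf : LCSmoothAt E E' f 1) : LCSmooth E E' f := by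
  intro p
  -- Near `p` one has `f x = f p * f (p⁻¹ * x)`, where `p⁻¹ * x` is close to the unit.
  have h1 : LCSmoothAt E E (fun x : G => p⁻¹ * x) p := (LCSmoothAt.id p).const_mul p⁻¹
  have h2 : LCSmoothAt E E' (fun x => f (p⁻¹ * x)) p :=
    LCSmoothAt.comp (by rwa [inv_mul_cancel]) h1
  exact (h2.const_mul (f p)).congr (Eventually.of_forall fun x => by
    simp only [← map_mul, mul_inv_cancel_left])

end LieGroups

section LieGroupTopology

variable (E : Type*) [AddCommGroup E] [Module ℝ E] [TopologicalSpace E]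
  {G : Type*} [Group G] [TopologicalSpace G] [ChartedSpace E G]

theorem isTopologicalGroup_of_lcSmooth (hm : LCSmooth (E × E) E (fun p : G × G => p.1 * p.2))
    (hi : LCSmooth E E (fun g : G => g⁻¹)) : IsTopologicalGroup G where
  continuous_mul := continuous_iff_continuousAt.2 fun p => (hm p).1
  continuous_inv := continuous_iff_continuousAt.2 fun p => (hi p).1

theorem LCLieGroup.isTopologicalGroup [LCLieGroup E G] : IsTopologicalGroup G :=
  isTopologicalGroup_of_lcSmooth E LCLieGroup.smooth_mul LCLieGroup.smooth_inv

end LieGroupTopology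

/-! ### Lie groups from local data -/

section LocalGroups

variable {E : Type*} [AddCommGroup E] [Module ℝ E] [TopologicalSpace E] [IsTopologicalAddGroup E]
  [ContinuousSMul ℝ E]
  {K : Type*} [AddCommGroup K] [Module ℝ K] [TopologicalSpace K] [IsTopologicalAddGroup K]
  [ContinuousSMul ℝ K]
  {B : Type*}

/-- Near `k`, the map `u` takes values in the domain of `ψ` and is smooth in this chart. -/
def SmoothNear (ψ : PartialEquiv B E) (u : K → B) (k : K) : Prop :=
  ∃ W : Set K, IsOpen W ∧ k ∈ W ∧ (∀ y ∈ W, u y ∈ ψ.source) ∧ LCSmoothOn W (fun y => ψ (u y))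

namespace SmoothNear

variable {ψ : PartialEquiv B E}

theorem symm_comp {f : K → E} {W : Set K} (hW : IsOpen W) {k : K} (hk : k ∈ W)
    (hf : LCSmoothOn W f) (hft : ∀ y ∈ W, f y ∈ ψ.target) :
    SmoothNear ψ (fun y => ψ.symm (f y)) k :=
  ⟨W, hW, hk, fun y hy => ψ.map_target (hft y hy), hf.congr hW fun y hy => ψ.right_inv (hft y hy)⟩

theorem symm_clm (ht : IsOpen ψ.target) (L : K →L[ℝ] E) {k : K} (hk : L k ∈ ψ.target) :
    SmoothNear ψ (fun y => ψ.symm (L y)) k :=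
  symm_comp (ht.preimage L.continuous) hk (LCSmoothOn.clm _ L) fun _ hy => hy

variable [LocallyConvexSpace ℝ E]

/-- `B` carries no topology yet, so smoothness is read off in the single chart `ψ`, by inserting
`ψ.symm ∘ ψ` between the two maps. -/
theorem comp {φ : B → B} {u : K → B} {k : K}
    (hφ : SmoothNear ψ (fun y => φ (ψ.symm y)) (ψ (u k))) (hu : SmoothNear ψ u k) :
    SmoothNear ψ (fun y => φ (u y)) k := by
  obtain ⟨W, hW, hkW, hWs, hsm⟩ := hu
  obtain ⟨V, hV, hkV, hVs, hsm'⟩ := hφ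
  have ho := hsm.continuousOn.isOpen_inter_preimage hW hV
  have heq : ∀ y ∈ W, ψ.symm (ψ (u y)) = u y := fun y hy => ψ.left_inv (hWs y hy)
  refine ⟨_, ho, ⟨hkW, hkV⟩, fun y hy => ?_, ?_⟩
  · simpa [heq y hy.1] using hVs _ hy.2
  · exact (hsm'.comp (hsm.mono inter_subset_left) ho hV fun y hy => hy.2).congr ho
      fun y hy => by simp [heq y hy.1]

theorem comp₂ {φ : B → B → B} {u v : K → B} {k : K}
    (hφ : SmoothNear ψ (fun p : E × E => φ (ψ.symm p.1) (ψ.symm p.2)) (ψ (u k), ψ (v k)))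
    (hu : SmoothNear ψ u k) (hv : SmoothNear ψ v k) :
    SmoothNear ψ (fun y => φ (u y) (v y)) k := by
  obtain ⟨W₁, hW₁, hkW₁, hWs₁, hsm₁⟩ := hu
  obtain ⟨W₂, hW₂, hkW₂, hWs₂, hsm₂⟩ := hv
  obtain ⟨V, hV, hkV, hVs, hsm'⟩ := hφ
  have hsm := (hsm₁.mono (inter_subset_left (t := W₂))).prodMk
    (hsm₂.mono (inter_subset_right (s := W₁)))
  have hW := hW₁.inter hW₂
  have ho := hsm.continuousOn.isOpen_inter_preimage hW hV
  have heq₁ : ∀ y ∈ W₁ ∩ W₂, ψ.symm (ψ (u y)) = u y := fun y hy => ψ.left_inv (hWs₁ y hy.1)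
  have heq₂ : ∀ y ∈ W₁ ∩ W₂, ψ.symm (ψ (v y)) = v y := fun y hy => ψ.left_inv (hWs₂ y hy.2)
  refine ⟨_, ho, ⟨⟨hkW₁, hkW₂⟩, hkV⟩, fun y hy => ?_, ?_⟩
  · simpa [heq₁ y hy.1, heq₂ y hy.1] using hVs _ hy.2
  · exact (hsm'.comp (hsm.mono inter_subset_left) ho hV fun y hy => hy.2).congr ho
      fun y hy => by simp [heq₁ y hy.1, heq₂ y hy.1]

/-- Partial maps of a map which is smooth near a point are smooth near that point. -/
theorem slice {u : K × K → B} {k : K} (hu : SmoothNear ψ u (k, k)) :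
    ∀ᶠ l in 𝓝 k, SmoothNear ψ (fun y => u (l, y)) k := by
  obtain ⟨W, hW, hkW, hWs, hsm⟩ := hu
  have h : ∀ᶠ l in 𝓝 k, (l, k) ∈ W :=
    (by fun_prop : Continuous fun l : K => (l, k)).continuousAt.preimage_mem_nhds
      (hW.mem_nhds hkW)
  filter_upwards [h] with l hl
  have hc : Continuous fun y : K => (l, y) := by fun_prop
  refine ⟨_, hW.preimage hc, hl, fun y hy => hWs _ hy, ?_⟩
  exact hsm.comp ((LCSmoothOn.const _ l).prodMk (LCSmoothOn.id _)) (hW.preimage hc) hW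
    fun y hy => hy

end SmoothNear

/-- The restriction of the chart `ψ` to the preimage of `N`. -/
def restrTarget (ψ : PartialEquiv B E) (N : Set E) : PartialEquiv B E := (ψ.symm.restr N).symm

theorem mem_restrTarget_source {ψ : PartialEquiv B E} {N : Set E} {b : B} :
    b ∈ (restrTarget ψ N).source ↔ b ∈ ψ.source ∧ ψ b ∈ N := by
  simp [restrTarget, PartialEquiv.restr]

theorem mem_restrTarget_target {ψ : PartialEquiv B E} {N : Set E} {y : E} :
    y ∈ (restrTarget ψ N).target ↔ y ∈ ψ.target ∧ y ∈ N := by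
  simp [restrTarget, PartialEquiv.restr]

theorem SmoothNear.restrTarget {ψ : PartialEquiv B E} {N : Set E} (hN : IsOpen N) {u : K → B}
    {k : K} (hu : SmoothNear ψ u k) (hk : ψ (u k) ∈ N) : SmoothNear (restrTarget ψ N) u k := by
  obtain ⟨W, hW, hkW, hWs, hsm⟩ := hu
  exact ⟨_, hsm.continuousOn.isOpen_inter_preimage hW hN, ⟨hkW, hk⟩,
    fun y hy => mem_restrTarget_source.2 ⟨hWs y hy.1, hy.2⟩, hsm.mono inter_subset_left⟩

variable (E B) [Group B]

/-- A chart of the group `B` at the unit, with values in `E`, in which the group operations are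
smooth near the unit. -/
structure LocalLieChart where
  chart : PartialEquiv B E
  open_target : IsOpen chart.target
  one_mem : 1 ∈ chart.source
  smooth_mul : SmoothNear chart (fun p : E × E => chart.symm p.1 * chart.symm p.2)
    (chart 1, chart 1)
  smooth_inv : SmoothNear chart (fun y : E => (chart.symm y)⁻¹) (chart 1)

/-- A local Lie group chart for which all left translations and conjugations are smooth. -/
structure LieChart extends LocalLieChart E B where
  open_translation : ∀ s, IsOpen {y | y ∈ chart.target ∧ s * chart.symm y ∈ chart.source}
  smooth_translation : ∀ s, LCSmoothOn {y | y ∈ chart.target ∧ s * chart.symm y ∈ chart.source}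
    (fun y => chart (s * chart.symm y))
  smooth_conj : ∀ b, SmoothNear chart (fun y : E => b * chart.symm y * b⁻¹) (chart 1)

variable {E B}

namespace LocalLieChart

variable (D : LocalLieChart E B)

theorem symm_chart_one : D.chart.symm (D.chart 1) = 1 := D.chart.left_inv D.one_mem

theorem chart_one_mem : D.chart 1 ∈ D.chart.target := D.chart.map_source D.one_mem

/-- The restriction of a local Lie group chart to a smaller unit neighbourhood. -/
def restr (N : Set E) (hN : IsOpen N) (h1 : D.chart 1 ∈ N) : LocalLieChart E B where
  chart := restrTarget D.chart N
  open_target := by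
    have : (restrTarget D.chart N).target = D.chart.target ∩ N := by
      ext y; exact mem_restrTarget_target
    rw [this]
    exact D.open_target.inter hN
  one_mem := mem_restrTarget_source.2 ⟨D.one_mem, h1⟩
  smooth_mul := D.smooth_mul.restrTarget hN (by simpa [symm_chart_one] using h1)
  smooth_inv := D.smooth_inv.restrTarget hN (by simpa [symm_chart_one] using h1)

variable [LocallyConvexSpace ℝ E]

variable {D}

theorem mul {u v : K → B} {k : K} (hu : SmoothNear D.chart u k) (hv : SmoothNear D.chart v k)
    (huk : u k = 1) (hvk : v k = 1) : SmoothNear D.chart (fun y => u y * v y) k :=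
  SmoothNear.comp₂ (φ := fun a b => a * b) (by rw [huk, hvk]; exact D.smooth_mul) hu hv

theorem inv {u : K → B} {k : K} (hu : SmoothNear D.chart u k)
    (huk : u k = 1) : SmoothNear D.chart (fun y => (u y)⁻¹) k :=
  SmoothNear.comp (φ := fun a => a⁻¹) (by rw [huk]; exact D.smooth_inv) hu

variable (D)

theorem smooth_symm_fst : SmoothNear D.chart (fun p : E × E => D.chart.symm p.1)
    (D.chart 1, D.chart 1) :=
  SmoothNear.symm_clm D.open_target (ContinuousLinearMap.fst ℝ E E) D.chart_one_mem

theorem smooth_symm_snd : SmoothNear D.chart (fun p : E × E => D.chart.symm p.2)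
    (D.chart 1, D.chart 1) :=
  SmoothNear.symm_clm D.open_target (ContinuousLinearMap.snd ℝ E E) D.chart_one_mem

/-- The group elements for which conjugation, in both directions, is smooth near the unit. -/
def conjSubgroup : Subgroup B where
  carrier := {b | SmoothNear D.chart (fun y : E => b * D.chart.symm y * b⁻¹) (D.chart 1) ∧
    SmoothNear D.chart (fun y : E => b⁻¹ * D.chart.symm y * b) (D.chart 1)}
  one_mem' := by
    have h : SmoothNear D.chart (fun y : E => D.chart.symm y) (D.chart 1) :=
      SmoothNear.symm_clm D.open_target (ContinuousLinearMap.id ℝ E) D.chart_one_mem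
    constructor <;> simpa using h
  -- Conjugation by a product is a composition of conjugations, each of which fixes the unit and
  -- hence the base point of the chart.
  mul_mem' := by
    rintro a b ⟨ha, ha'⟩ ⟨hb, hb'⟩
    constructor
    · have := SmoothNear.comp (φ := fun x => a * x * a⁻¹)
        (by simpa [D.symm_chart_one] using ha) hb
      simpa [mul_assoc] using this
    · have := SmoothNear.comp (φ := fun x => b⁻¹ * x * b)
        (by simpa [D.symm_chart_one] using hb') ha'
      simpa [mul_assoc] using this
  inv_mem' := by
    rintro a ⟨ha, ha'⟩
    exact ⟨by simpa using ha', by simpa using ha⟩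

theorem center_le_conjSubgroup : Subgroup.center B ≤ D.conjSubgroup := by
  intro b hb
  have h : SmoothNear D.chart (fun y : E => D.chart.symm y) (D.chart 1) :=
    SmoothNear.symm_clm D.open_target (ContinuousLinearMap.id ℝ E) D.chart_one_mem
  have hc := Subgroup.mem_center_iff.1 hb
  constructor
  · simpa [← hc] using h
  · simpa [mul_assoc, hc] using h

/-- The maps `(x, y) ↦ x y x⁻¹` and `(x, y) ↦ x⁻¹ y x` are jointly smooth near `(1, 1)`; fixing `x`
close to `1` leaves maps that are smooth in `y` near `1`. -/
theorem eventually_mem_conjSubgroup :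
    ∀ᶠ y in 𝓝 (D.chart 1), D.chart.symm y ∈ D.conjSubgroup := by
  have h1 := D.smooth_symm_fst
  have h2 := D.smooth_symm_snd
  have e := D.symm_chart_one
  have h3 := inv h1 e
  have h4 := mul (mul h1 h2 e e) h3 (by simp [e]) (by simp [e])
  have h5 := mul (mul h3 h2 (by simp [e]) e) h1 (by simp [e]) e
  filter_upwards [h4.slice, h5.slice] with y hy hy' using ⟨hy, hy'⟩

/-- Conjugations are smooth by the generation hypothesis. For translations, the chart is shrunk to
`N` such that `a b⁻¹ c` is defined and smooth for `a, b, c ∈ N`. A translation that moves some point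
of the small chart back into it is of the form `c ↦ a b⁻¹ c` with such `a, b`, and is therefore
smooth on the whole chart. -/
theorem exists_lieChart (hgen : ∀ S : Subgroup B, Subgroup.center B ≤ S →
      (∀ᶠ y in 𝓝 (D.chart 1), D.chart.symm y ∈ S) → S = ⊤) :
    ∃ N : Set E, IsOpen N ∧ D.chart 1 ∈ N ∧
      ∃ D' : LieChart E B, D'.chart = restrTarget D.chart N := by
  have hconj : ∀ b, b ∈ D.conjSubgroup := by
    rw [hgen _ D.center_le_conjSubgroup D.eventually_mem_conjSubgroup]
    exact fun b => trivial
  have e := D.symm_chart_one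
  have h1 : SmoothNear D.chart (fun p : E × E × E => D.chart.symm p.1)
      (D.chart 1, D.chart 1, D.chart 1) :=
    SmoothNear.symm_clm D.open_target (ContinuousLinearMap.fst ℝ E (E × E)) D.chart_one_mem
  have h2 : SmoothNear D.chart (fun p : E × E × E => D.chart.symm p.2.1)
      (D.chart 1, D.chart 1, D.chart 1) :=
    SmoothNear.symm_clm D.open_target ((ContinuousLinearMap.fst ℝ E E).comp
      (ContinuousLinearMap.snd ℝ E (E × E))) D.chart_one_mem
  have h3 : SmoothNear D.chart (fun p : E × E × E => D.chart.symm p.2.2)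
      (D.chart 1, D.chart 1, D.chart 1) :=
    SmoothNear.symm_clm D.open_target ((ContinuousLinearMap.snd ℝ E E).comp
      (ContinuousLinearMap.snd ℝ E (E × E))) D.chart_one_mem
  obtain ⟨W, hW, h1W, hWs, hsm⟩ := mul (mul h1 (inv h2 e) e (by simp [e])) h3 (by simp [e]) e
  have hWn := hW.mem_nhds h1W
  rw [nhds_prod_eq, nhds_prod_eq] at hWn
  obtain ⟨N₁, hN₁, Q, hQ, hNQ⟩ := Filter.mem_prod_iff.1 hWn
  obtain ⟨N₂, hN₂, N₃, hN₃, hNQ'⟩ := Filter.mem_prod_iff.1 hQ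
  obtain ⟨N, hNs, hN, h1N⟩ := mem_nhds_iff.1 (inter_mem hN₁ (inter_mem hN₂ hN₃))
  have hNW : ∀ a ∈ N, ∀ b ∈ N, ∀ c ∈ N, (a, b, c) ∈ W := fun a ha b hb c hc =>
    hNQ ⟨(hNs ha).1, hNQ' ⟨(hNs hb).2.1, (hNs hc).2.2⟩⟩
  have key : ∀ s, IsOpen {y | y ∈ (restrTarget D.chart N).target ∧
        s * D.chart.symm y ∈ (restrTarget D.chart N).source} ∧
      LCSmoothOn {y | y ∈ (restrTarget D.chart N).target ∧
        s * D.chart.symm y ∈ (restrTarget D.chart N).source}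
        (fun y => D.chart (s * D.chart.symm y)) := by
    intro s
    -- If no point returns to the chart, there is nothing to prove; otherwise a returning point
    -- expresses `s` through two elements of the chart.
    rcases eq_empty_or_nonempty {y | y ∈ (restrTarget D.chart N).target ∧
        s * D.chart.symm y ∈ (restrTarget D.chart N).source} with he | ⟨y₀, hy₀, hy₀'⟩
    · rw [he]
      exact ⟨isOpen_empty, (LCSmoothOn.const ∅ (0 : E)).congr isOpen_empty fun _ h => h.elim⟩
    have hT : IsOpen (restrTarget D.chart N).target := (D.restr N hN h1N).open_target
    rw [mem_restrTarget_source] at hy₀'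
    rw [mem_restrTarget_target] at hy₀
    set y₁ := D.chart (s * D.chart.symm y₀) with hy₁
    have hs : s = D.chart.symm y₁ * (D.chart.symm y₀)⁻¹ := by
      rw [hy₁, D.chart.left_inv hy₀'.1, mul_inv_cancel_right]
    have hmaps : MapsTo (fun y : E => (y₁, y₀, y)) (restrTarget D.chart N).target W :=
      fun y hy => hNW _ hy₀'.2 _ hy₀.2 _ (mem_restrTarget_target.1 hy).2
    have hsmT : LCSmoothOn (restrTarget D.chart N).target
        (fun y => D.chart (s * D.chart.symm y)) := by
      have := hsm.comp ((LCSmoothOn.const _ y₁).prodMk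
        ((LCSmoothOn.const _ y₀).prodMk (LCSmoothOn.id _))) hT hW hmaps
      exact this.congr hT fun y hy => by rw [hs]
    -- Membership in the original chart domain is automatic by the choice of `N`, so only the open
    -- condition of landing in `N` remains.
    have hset : {y | y ∈ (restrTarget D.chart N).target ∧
        s * D.chart.symm y ∈ (restrTarget D.chart N).source} =
        (restrTarget D.chart N).target ∩ (fun y => D.chart (s * D.chart.symm y)) ⁻¹' N := by
      ext y
      refine and_congr_right fun hy => ?_
      rw [mem_restrTarget_source]
      refine and_iff_right ?_
      have := hWs _ (hmaps hy)
      simpa only [← hs] using this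
    rw [hset]
    exact ⟨hsmT.continuousOn.isOpen_inter_preimage hT hN, hsmT.mono inter_subset_left⟩
  refine ⟨N, hN, h1N, ⟨D.restr N hN h1N, fun s => (key s).1, fun s => (key s).2, fun b => ?_⟩, rfl⟩
  exact (hconj b).1.restrTarget hN (by simpa [e] using h1N)

end LocalLieChart

end LocalGroups

/-! ### The Lie group obtained by left translating a unit chart -/

section LieStructures

variable {E : Type*} [AddCommGroup E] [Module ℝ E] [TopologicalSpace E] [IsTopologicalAddGroup E]
  [ContinuousSMul ℝ E] {B : Type*} [Group B]

namespace LieChart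

variable (D : LieChart E B)

/-- The left translate by `b` of the chart of `D`. -/
def leftChart (b : B) : PartialEquiv B E where
  toFun x := D.chart (b⁻¹ * x)
  invFun y := b * D.chart.symm y
  source := {x | b⁻¹ * x ∈ D.chart.source}
  target := D.chart.target
  map_source' _ hx := D.chart.map_source hx
  map_target' y hy := by
    show b⁻¹ * (b * D.chart.symm y) ∈ D.chart.source
    rw [inv_mul_cancel_left]
    exact D.chart.map_target hy
  left_inv' x hx := by rw [D.chart.left_inv hx, mul_inv_cancel_left]
  right_inv' y hy := by rw [inv_mul_cancel_left, D.chart.right_inv hy]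

/-- The coordinate change from the chart at `b` to the chart at `b'` is left translation by `b'⁻¹ b`
in the unit chart, which is what the translation fields of `LieChart` control. -/
theorem leftChart_trans_source (b b' : B) :
    ((D.leftChart b).symm.trans (D.leftChart b')).source =
      {y | y ∈ D.chart.target ∧ b'⁻¹ * b * D.chart.symm y ∈ D.chart.source} := by
  ext y
  simp [leftChart, mul_assoc]

theorem leftChart_smooth_coordChange (b b' : B) :
    LCSmoothOn ((D.leftChart b).symm.trans (D.leftChart b')).source
      (D.leftChart b' ∘ (D.leftChart b).symm) := by
  rw [leftChart_trans_source]
  refine (D.smooth_translation (b'⁻¹ * b)).congr (D.open_translation _) fun y _ => ?_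
  simp [leftChart, mul_assoc]

/-- The atlas of left translates. -/
def core : ChartedSpaceCore E B where
  atlas := range D.leftChart
  chartAt := D.leftChart
  mem_chart_source b := by
    show b⁻¹ * b ∈ D.chart.source
    rw [inv_mul_cancel]
    exact D.one_mem
  chart_mem_atlas := mem_range_self
  open_source := by
    rintro _ _ ⟨b, rfl⟩ ⟨b', rfl⟩
    rw [leftChart_trans_source]
    exact D.open_translation _
  continuousOn_toFun := by
    rintro _ _ ⟨b, rfl⟩ ⟨b', rfl⟩
    exact (D.leftChart_smooth_coordChange b b').continuousOn

/-- A `T0` topological group is Hausdorff. Inseparable points lie in a common chart domain, where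
the chart distinguishes distinct points. -/
theorem t2Space_of_chartedSpace [T2Space E] [T : TopologicalSpace B] [C : ChartedSpace E B]
    [IsTopologicalGroup B] : T2Space B := by
  have : T0Space B := by
    rw [t0Space_iff_inseparable]
    intro x y h
    have hy : y ∈ (chartAt E x).source :=
      (h.mem_open_iff (chartAt E x).open_source).1 (mem_chart_source E x)
    by_contra hne
    have hne' : chartAt E x x ≠ chartAt E x y := fun he =>
      hne ((chartAt E x).injOn (mem_chart_source E x) hy he)
    have ho := (chartAt E x).isOpen_inter_preimage (isOpen_compl_singleton (x := chartAt E x y))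
    exact ((h.mem_open_iff ho).1 ⟨mem_chart_source E x, hne'⟩).2 rfl
  infer_instance

variable [LocallyConvexSpace ℝ E]

/-- The Lie group structure defined by a Lie group chart. -/
def lieStructure [T2Space E] : LieStructure E B where
  top := D.core.toTopologicalSpace
  charts := D.core.toChartedSpace
  isLie := by
    let _ : TopologicalSpace B := D.core.toTopologicalSpace
    let _ : ChartedSpace E B := D.core.toChartedSpace
    have e := D.symm_chart_one
    have hm : LCSmooth (E × E) E (fun p : B × B => p.1 * p.2) := by
      rintro ⟨a, b⟩
      rw [lcSmoothAt_iff]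
      -- In left translated charts the product at `(a, b)` is `(x, y) ↦ (b⁻¹ x b) y`: conjugation
      -- followed by multiplication near the unit.
      have hb := D.smooth_conj b⁻¹
      have h1 : SmoothNear D.chart (fun p : E × E => b⁻¹ * D.chart.symm p.1 * b)
          (D.chart 1, D.chart 1) := by
        refine SmoothNear.comp (φ := fun x => b⁻¹ * x * b) ?_ D.smooth_symm_fst
        simpa [e] using hb
      obtain ⟨W, hW, h1W, hWs, hsm⟩ :=
        LocalLieChart.mul h1 D.smooth_symm_snd (by simp [e]) e
      have hO : IsOpen (W ∩ D.chart.target ×ˢ D.chart.target) :=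
        hW.inter (D.open_target.prod D.open_target)
      have halg : ∀ y : E × E, (a * b)⁻¹ * (a * D.chart.symm y.1 * (b * D.chart.symm y.2)) =
          b⁻¹ * D.chart.symm y.1 * b * D.chart.symm y.2 := fun y => by group
      have hpt : chartAt (E × E) (a, b) (a, b) = (D.chart 1, D.chart 1) := by
        show (D.chart (a⁻¹ * a), D.chart (b⁻¹ * b)) = _
        simp
      rw [hpt]
      refine ⟨_, hO, ⟨h1W, D.chart_one_mem, D.chart_one_mem⟩, fun y hy => hy.2, fun y hy => ?_,
        (hsm.mono inter_subset_left).congr hO fun y hy => ?_⟩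
      · show (a * b)⁻¹ * (a * D.chart.symm y.1 * (b * D.chart.symm y.2)) ∈ D.chart.source
        rw [halg]
        exact hWs y hy.1
      · show D.chart ((a * b)⁻¹ * (a * D.chart.symm y.1 * (b * D.chart.symm y.2))) = _
        rw [halg]
    have hi : LCSmooth E E (fun b : B => b⁻¹) := by
      intro a
      rw [lcSmoothAt_iff]
      have h1 : SmoothNear D.chart (fun y : E => D.chart.symm y) (D.chart 1) :=
        SmoothNear.symm_clm D.open_target (ContinuousLinearMap.id ℝ E) D.chart_one_mem
      have h2 := LocalLieChart.inv h1 e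
      -- In left translated charts inversion at `a` is `x ↦ a x⁻¹ a⁻¹`.
      obtain ⟨W, hW, h1W, hWs, hsm⟩ := SmoothNear.comp (φ := fun x => a * x * a⁻¹)
        (by simpa [e] using D.smooth_conj a) h2
      have hO : IsOpen (W ∩ D.chart.target) := hW.inter D.open_target
      have halg : ∀ y : E, a⁻¹⁻¹ * (a * D.chart.symm y)⁻¹ = a * (D.chart.symm y)⁻¹ * a⁻¹ :=
        fun y => by group
      have hpt : chartAt E a a = D.chart 1 := by
        show D.chart (a⁻¹ * a) = _
        simp
      rw [hpt]
      refine ⟨_, hO, ⟨h1W, D.chart_one_mem⟩, fun y hy => hy.2, fun y hy => ?_,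
        (hsm.mono inter_subset_left).congr hO fun y hy => ?_⟩
      · show a⁻¹⁻¹ * (a * D.chart.symm y)⁻¹ ∈ D.chart.source
        rw [halg]
        exact hWs y hy.1
      · show D.chart (a⁻¹⁻¹ * (a * D.chart.symm y)⁻¹) = _
        rw [halg]
    have := isTopologicalGroup_of_lcSmooth E hm hi
    exact
      { t2 := t2Space_of_chartedSpace (E := E)
        smooth_coordChange := by
          intro e he e' he'
          obtain ⟨c, hc, rfl⟩ : ∃ (c : PartialEquiv B E) (hc : c ∈ D.core.atlas),
            e = D.core.openPartialHomeomorph c hc := by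
            have h : e ∈ ⋃ (c : PartialEquiv B E) (hc : c ∈ D.core.atlas),
              {D.core.openPartialHomeomorph c hc} := he
            simpa only [mem_iUnion, mem_singleton_iff] using h
          obtain ⟨c', hc', rfl⟩ : ∃ (c : PartialEquiv B E) (hc : c ∈ D.core.atlas),
            e' = D.core.openPartialHomeomorph c hc := by
            have h : e' ∈ ⋃ (c : PartialEquiv B E) (hc : c ∈ D.core.atlas),
              {D.core.openPartialHomeomorph c hc} := he'
            simpa only [mem_iUnion, mem_singleton_iff] using h
          obtain ⟨b, rfl⟩ := hc
          obtain ⟨b', rfl⟩ := hc'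
          exact D.leftChart_smooth_coordChange b b'
        smooth_mul := hm
        smooth_inv := hi }

variable [T2Space E]

/-- The chart of `D` at the unit, as a chart of the Lie group defined by `D`. -/
def unitChart : PartialEquiv D.lieStructure.Carrier E := D.chart

theorem chartAt_apply (b x : D.lieStructure.Carrier) :
    chartAt E b x = D.unitChart (b⁻¹ * x) := rfl

theorem chartAt_symm_apply (b : D.lieStructure.Carrier) (y : E) :
    (chartAt E b).symm y = b * D.unitChart.symm y := rfl

theorem mem_chartAt_source {b x : D.lieStructure.Carrier} :
    x ∈ (chartAt E b).source ↔ b⁻¹ * x ∈ D.unitChart.source := Iff.rfl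

theorem open_unitChart_target : IsOpen D.unitChart.target := D.open_target

theorem unitChart_one_mem : D.unitChart 1 ∈ D.unitChart.target := D.chart_one_mem

end LieChart

end LieStructures

/-! ### The algebra of the band -/

section BandAlgebra

variable {A Z : Type*} [AddCommGroup A] [AddCommGroup Z] {τ : A →+ Z} {G : Type*} [Group G]
  (c : GenCocycle τ G)

theorem bandClass_eq_iff {p q : Z × G} :
    bandClass c p = bandClass c q ↔ q.1 - p.1 ∈ τ.range ∧ p.2 = q.2 := by
  unfold bandClass
  rw [toSkeleton_eq_toSkeleton_iff]
  constructor
  · rintro ⟨i⟩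
    refine ⟨⟨i.hom.a, ?_⟩, i.hom.elt_eq.symm⟩
    have h : q.1 = τ i.hom.a + p.1 := i.hom.tgt
    exact (sub_eq_iff_eq_add.2 h).symm
  · rintro ⟨⟨a, ha⟩, h⟩
    exact ⟨CocycleObj.mkIso a (by show q.1 = τ a + p.1; rw [ha, sub_add_cancel]) h.symm⟩

theorem bandClass_surjective : Function.Surjective (bandClass c) := by
  intro b
  induction b using Quotient.inductionOn with
  | h X => exact ⟨(X.val, X.elt), rfl⟩

theorem bandClass_mul (p q : Z × G) :
    bandClass c p * bandClass c q = bandClass c (p.1 + q.1 + c.F p.2 q.2, p.2 * q.2) :=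
  (Skeleton.toSkeleton_tensorObj _ _).symm

theorem bandClass_one : bandClass c (0, 1) = 1 := (Skeleton.one_eq).symm

theorem bandClass_inv (p : Z × G) :
    (bandClass c p)⁻¹ = bandClass c (-p.1 - c.F p.2 p.2⁻¹, p.2⁻¹) := rfl

theorem bandIncl_apply (x : Z) :
    bandIncl c (Multiplicative.ofAdd (x : Z ⧸ τ.range)) = bandClass c (x, 1) :=
  (cocycleIncl c).mapSkeleton_obj_toSkeleton ⟨x⟩

theorem bandProj_apply (p : Z × G) : bandProj c (bandClass c p) = p.2 :=
  congrArg (skelDiscreteHom G) ((cocycleProj c).mapSkeleton_obj_toSkeleton ⟨p.1, p.2⟩)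

theorem bandIncl_mul (x : Z) (p : Z × G) :
    bandIncl c (Multiplicative.ofAdd (x : Z ⧸ τ.range)) * bandClass c p =
      bandClass c (x + p.1, p.2) := by
  rw [bandIncl_apply, bandClass_mul, c.F_one_left, one_mul, add_zero]

/-- The map `[(x, g)] ↦ [x]` from the band to `Z / τ(A)`. -/
def bandFibreCoord (b : Band c) : Multiplicative (Z ⧸ τ.range) :=
  Quotient.lift (s := isIsomorphicSetoid (CocycleObj c))
    (fun X => Multiplicative.ofAdd (X.val : Z ⧸ τ.range))
    (fun X Y ⟨i⟩ => congrArg Multiplicative.ofAdd (QuotientAddGroup.eq.2 ⟨i.hom.a, by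
      rw [i.hom.tgt]; abel⟩)) b

theorem bandFibreCoord_apply (p : Z × G) :
    bandFibreCoord c (bandClass c p) = Multiplicative.ofAdd (p.1 : Z ⧸ τ.range) := rfl

/-- The fibre coordinate need not be a homomorphism, but it is a left inverse of the inclusion. With
the equivariance below, it supplies the inverses of the bundle trivialisations. -/
theorem bandFibreCoord_incl (h : Multiplicative (Z ⧸ τ.range)) :
    bandFibreCoord c (bandIncl c h) = h := by
  induction h using Multiplicative.rec with
  | _ h =>
  induction h using QuotientAddGroup.induction_on with
  | H x => rw [bandIncl_apply, bandFibreCoord_apply]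

theorem bandFibreCoord_incl_mul (h : Multiplicative (Z ⧸ τ.range)) (b : Band c) :
    bandFibreCoord c (bandIncl c h * b) = h * bandFibreCoord c b := by
  obtain ⟨p, rfl⟩ := bandClass_surjective c b
  induction h using Multiplicative.rec with
  | _ h =>
  induction h using QuotientAddGroup.induction_on with
  | H x =>
    rw [bandIncl_mul]
    rfl

theorem bandIncl_injective : Function.Injective (bandIncl c) :=
  Function.LeftInverse.injective (bandFibreCoord_incl c)

theorem bandIncl_bandFibreCoord {b : Band c} (hb : bandProj c b = 1) :
    bandIncl c (bandFibreCoord c b) = b := by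
  obtain ⟨⟨x, g⟩, rfl⟩ := bandClass_surjective c b
  rw [bandProj_apply] at hb
  obtain rfl : g = 1 := hb
  rw [bandFibreCoord_apply, bandIncl_apply]

theorem bandProj_bandIncl (h : Multiplicative (Z ⧸ τ.range)) :
    bandProj c (bandIncl c h) = 1 := by
  induction h using Multiplicative.rec with
  | _ h =>
  induction h using QuotientAddGroup.induction_on with
  | H x => rw [bandIncl_apply, bandProj_apply]

theorem bandIncl_range_eq_ker : (bandIncl c).range = (bandProj c).ker := by
  ext b
  constructor
  · rintro ⟨h, rfl⟩
    exact bandProj_bandIncl c h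
  · intro hb
    exact ⟨_, bandIncl_bandFibreCoord c hb⟩

theorem bandProj_surjective : Function.Surjective (bandProj c) :=
  fun g => ⟨bandClass c (0, g), bandProj_apply c _⟩

/-- Both products of `(x, 1)` with `(y, g)` have first component `x + y`, since `F` vanishes when an
argument is `1`. -/
theorem bandIncl_range_le_center : (bandIncl c).range ≤ Subgroup.center (Band c) := by
  rintro _ ⟨h, rfl⟩
  rw [Subgroup.mem_center_iff]
  intro b
  obtain ⟨p, rfl⟩ := bandClass_surjective c b
  induction h using Multiplicative.rec with
  | _ h =>
  induction h using QuotientAddGroup.induction_on with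
  | H x =>
    show bandClass c p * bandIncl c (Multiplicative.ofAdd (x : Z ⧸ τ.range)) =
      bandIncl c (Multiplicative.ofAdd (x : Z ⧸ τ.range)) * bandClass c p
    rw [bandIncl_apply, bandClass_mul, bandClass_mul, c.F_one_left, c.F_one_right, one_mul, mul_one, add_comm x]

end BandAlgebra

/-! ### Lie group charts of the quotient and of the band -/

section Construction

/-- Choose an open `O` meeting `D` only in `0`, and `V` with `V - V ⊆ O`. Then `V` injects into the
quotient by `D`. -/
theorem exists_open_injOn_of_discrete {Z : Type*} [AddCommGroup Z] [TopologicalSpace Z]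
    [IsTopologicalAddGroup Z] (D : AddSubgroup Z) [DiscreteTopology D] :
    ∃ V : Set Z, IsOpen V ∧ 0 ∈ V ∧ ∀ x ∈ V, ∀ y ∈ V, y - x ∈ D → x = y := by
  obtain ⟨O, hO, hOD⟩ := isOpen_induced_iff.1 (isOpen_discrete ({0} : Set D))
  have h0 : O ∈ 𝓝 ((0 : Z) - 0) := by
    rw [sub_zero]
    refine hO.mem_nhds ?_
    have : (0 : D) ∈ Subtype.val ⁻¹' O := by rw [hOD]; rfl
    exact this
  have h1 : (fun p : Z × Z => p.1 - p.2) ⁻¹' O ∈ 𝓝 ((0 : Z), (0 : Z)) :=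
    continuous_sub.continuousAt.preimage_mem_nhds h0
  rw [nhds_prod_eq] at h1
  obtain ⟨N₁, hN₁, N₂, hN₂, h⟩ := Filter.mem_prod_iff.1 h1
  obtain ⟨V, hVs, hV, h0V⟩ := mem_nhds_iff.1 (inter_mem hN₁ hN₂)
  refine ⟨V, hV, h0V, fun x hx y hy hxy => ?_⟩
  have h2 : (⟨y - x, hxy⟩ : D) ∈ Subtype.val ⁻¹' O := h (mk_mem_prod (hVs hy).1 (hVs hx).2)
  rw [hOD] at h2
  exact (sub_eq_zero.1 (congrArg Subtype.val h2)).symm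

variable {E : Type*} [AddCommGroup E] [Module ℝ E] [TopologicalSpace E] [IsTopologicalAddGroup E]
  [ContinuousSMul ℝ E] {B : Type*} [Group B]

/-- The local Lie group chart given by an injective parametrisation `f` of a unit neighbourhood. -/
def LocalLieChart.ofInjOn (f : E → B) {s : Set E} (hs : IsOpen s) (hf : InjOn f s) {o : E}
    (ho : o ∈ s) (hfo : f o = 1)
    (hm : ∃ (μ : E × E → E) (W : Set (E × E)), IsOpen W ∧ (o, o) ∈ W ∧ LCSmoothOn W μ ∧
      μ (o, o) = o ∧ ∀ p ∈ W, f p.1 * f p.2 = f (μ p))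
    (hi : ∃ (ι : E → E) (W : Set E), IsOpen W ∧ o ∈ W ∧ LCSmoothOn W ι ∧
      ι o = o ∧ ∀ p ∈ W, (f p)⁻¹ = f (ι p)) : LocalLieChart E B where
  chart := (hf.toPartialEquiv f s).symm
  open_target := hs
  one_mem := ⟨o, ho, hfo⟩
  smooth_mul := by
    have e : (hf.toPartialEquiv f s).symm 1 = o := by
      rw [← hfo]; exact (hf.toPartialEquiv f s).left_inv ho
    rw [e]
    obtain ⟨μ, W, hW, hoW, hsm, hμ, hfμ⟩ := hm
    -- The domain is cut down to the points where `μ` lands in `s`, on which `f` can be inverted.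
    have hO := hsm.continuousOn.isOpen_inter_preimage hW hs
    refine ⟨_, hO, ⟨hoW, by rw [mem_preimage, hμ]; exact ho⟩, fun p hp => ⟨μ p, hp.2, ?_⟩,
      (hsm.mono inter_subset_left).congr hO fun p hp => ?_⟩
    · exact (hfμ p hp.1).symm
    · show (hf.toPartialEquiv f s).symm (f p.1 * f p.2) = μ p
      rw [hfμ p hp.1]
      exact (hf.toPartialEquiv f s).left_inv hp.2
  smooth_inv := by
    have e : (hf.toPartialEquiv f s).symm 1 = o := by
      rw [← hfo]; exact (hf.toPartialEquiv f s).left_inv ho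
    rw [e]
    obtain ⟨ι, W, hW, hoW, hsm, hι, hfι⟩ := hi
    have hO := hsm.continuousOn.isOpen_inter_preimage hW hs
    refine ⟨_, hO, ⟨hoW, by rw [mem_preimage, hι]; exact ho⟩, fun p hp => ⟨ι p, hp.2, ?_⟩,
      (hsm.mono inter_subset_left).congr hO fun p hp => ?_⟩
    · exact (hfι p hp.1).symm
    · show (hf.toPartialEquiv f s).symm (f p)⁻¹ = ι p
      rw [hfι p hp.1]
      exact (hf.toPartialEquiv f s).left_inv hp.2

/-- A parametrisation `f` of a unit neighbourhood in which multiplication and inversion are smooth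
yields a Lie group chart, provided that the group is generated by its center and any
unit neighbourhood. -/
theorem exists_lieChart_of_injOn [LocallyConvexSpace ℝ E] (f : E → B) {s : Set E} (hs : IsOpen s)
    (hf : InjOn f s) {o : E} (ho : o ∈ s) (hfo : f o = 1)
    (hm : ∃ (μ : E × E → E) (W : Set (E × E)), IsOpen W ∧ (o, o) ∈ W ∧ LCSmoothOn W μ ∧
      μ (o, o) = o ∧ ∀ p ∈ W, f p.1 * f p.2 = f (μ p))
    (hi : ∃ (ι : E → E) (W : Set E), IsOpen W ∧ o ∈ W ∧ LCSmoothOn W ι ∧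
      ι o = o ∧ ∀ p ∈ W, (f p)⁻¹ = f (ι p))
    (hgen : ∀ S : Subgroup B, Subgroup.center B ≤ S → (∀ᶠ y in 𝓝 o, f y ∈ S) → S = ⊤) :
    ∃ D : LieChart E B, (∀ y, D.chart.symm y = f y) ∧ D.chart 1 = o := by
  set D := LocalLieChart.ofInjOn f hs hf ho hfo hm hi
  have e : D.chart 1 = o := by
    show (hf.toPartialEquiv f s).symm 1 = o
    rw [← hfo]; exact (hf.toPartialEquiv f s).left_inv ho
  obtain ⟨N, hN, h1N, D', hD'⟩ := D.exists_lieChart fun S hS h => hgen S hS (by rwa [e] at h)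
  -- Restricting a chart leaves its underlying functions unchanged, so the inverse chart is `f`
  -- everywhere, also off the target.
  refine ⟨D', fun y => ?_, ?_⟩
  · rw [hD']; rfl
  · rw [hD']; exact e

variable {𝔷 A G : Type*} [AddCommGroup 𝔷] [Module ℝ 𝔷] [TopologicalSpace 𝔷]
  [IsTopologicalAddGroup 𝔷] [ContinuousSMul ℝ 𝔷] [LocallyConvexSpace ℝ 𝔷]
  [AddCommGroup A]

/-- Addition and negation of `𝔷` express the group operations globally, and the generation condition
is trivial because a commutative group is its own centre. -/
theorem exists_lieChart_quotient (τ : A →+ 𝔷) [DiscreteTopology τ.range] :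
    ∃ D : LieChart 𝔷 (Multiplicative (𝔷 ⧸ τ.range)),
      (∀ y, D.chart.symm y = Multiplicative.ofAdd (y : 𝔷 ⧸ τ.range)) ∧ D.chart 1 = 0 := by
  obtain ⟨V, hV, h0V, hinj⟩ := exists_open_injOn_of_discrete τ.range
  obtain ⟨D, hD, hD1⟩ := exists_lieChart_of_injOn
    (fun y : 𝔷 => Multiplicative.ofAdd (y : 𝔷 ⧸ τ.range)) hV (fun x hx y hy h => by
      refine hinj x hx y hy ?_
      rw [sub_eq_neg_add]
      exact QuotientAddGroup.eq.1 (Multiplicative.ofAdd.injective h)) h0V rfl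
    ⟨fun p => p.1 + p.2, univ, isOpen_univ, trivial, LCSmoothOn.clm _
      (ContinuousLinearMap.fst ℝ 𝔷 𝔷 + ContinuousLinearMap.snd ℝ 𝔷 𝔷), add_zero _, fun _ _ => rfl⟩
    ⟨fun p => -p, univ, isOpen_univ, trivial, LCSmoothOn.clm _
      (-ContinuousLinearMap.id ℝ 𝔷), neg_zero, fun _ _ => rfl⟩
    (fun S hS _ => top_le_iff.1 (by rwa [CommGroup.center_eq_top] at hS))
  exact ⟨D, hD, hD1⟩

variable [LocallyConvexSpace ℝ E] [Group G] [TopologicalSpace G] [ChartedSpace E G]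

/-- A map on `G × G` which is smooth near the unit, in the preferred charts. -/
theorem LCSmoothAt.exists_smoothOn_prod {E' N : Type*} [AddCommGroup E'] [Module ℝ E']
    [TopologicalSpace E'] [IsTopologicalAddGroup E'] [ContinuousSMul ℝ E'] [TopologicalSpace N]
    [ChartedSpace E' N] {f : G × G → N} {q : N} (hf : LCSmoothAt (E × E) E' f 1) (hq : f 1 = q) :
    ∃ W : Set (E × E), IsOpen W ∧ (chartAt E (1 : G) 1, chartAt E (1 : G) 1) ∈ W ∧
      (∀ y ∈ W, y.1 ∈ (chartAt E (1 : G)).target ∧ y.2 ∈ (chartAt E (1 : G)).target ∧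
        f ((chartAt E (1 : G)).symm y.1, (chartAt E (1 : G)).symm y.2) ∈
          (chartAt E' q).source) ∧
      LCSmoothOn W (fun y => chartAt E' q
        (f ((chartAt E (1 : G)).symm y.1, (chartAt E (1 : G)).symm y.2))) := by
  obtain ⟨W, hW, h1W, hWt, hWs, hsm⟩ := lcSmoothAt_iff.1 hf
  -- Charts at `f 1` are replaced by charts at `q`, since `1 * 1` and `1` are equal only after
  -- rewriting.
  rw [hq] at hWs hsm
  exact ⟨W, hW, h1W, fun y hy => ⟨(hWt hy).1, (hWt hy).2, hWs y hy⟩, hsm⟩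

variable [LCLieGroup E G] {τ : A →+ 𝔷}

/-- The parametrisation is `(x, y) ↦ [(x, χ⁻¹ y)]` on `V × χ.target`. It is injective since `V`
injects modulo `τ(A)`, and the group operations involve only `F` and the operations of `G`.
Connectedness of `G` enters through the generation condition. -/
theorem exists_lieChart_band [ConnectedSpace G] [DiscreteTopology τ.range] (c : GenCocycle τ G)
    (hF : LCSmoothAt (E × E) 𝔷 (fun p : G × G => c.F p.1 p.2) 1) :
    ∃ D : LieChart (𝔷 × E) (Band c),
      (∀ y, D.chart.symm y = bandClass c (y.1, (chartAt E (1 : G)).symm y.2)) ∧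
      D.chart 1 = (0, chartAt E (1 : G) 1) := by
  have : IsTopologicalGroup G := LCLieGroup.isTopologicalGroup E
  obtain ⟨V, hV, h0V, hinj⟩ := exists_open_injOn_of_discrete τ.range
  set χ := chartAt E (1 : G) with hχ
  have hχ1 : χ.symm (χ 1) = 1 := χ.left_inv (mem_chart_source E 1)
  have h1t : χ 1 ∈ χ.target := χ.map_source (mem_chart_source E 1)
  obtain ⟨WF, hWF, h1WF, -, hsF⟩ := hF.exists_smoothOn_prod (q := (0 : 𝔷)) (c.F_one_left 1)
  obtain ⟨Wm, hWm, h1Wm, hWmt, hsm⟩ := (LCLieGroup.smooth_mul (E := E) (1 : G × G)).exists_smoothOn_prod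
    (q := (1 : G)) (one_mul 1)
  have hinv := lcSmoothAt_iff.1 (LCLieGroup.smooth_inv (E := E) (1 : G))
  rw [inv_one] at hinv
  obtain ⟨Wi, hWi, h1Wi, hWit, hWis, hsi⟩ := hinv
  have hm : ∃ (μ : (𝔷 × E) × (𝔷 × E) → 𝔷 × E) (W : Set ((𝔷 × E) × (𝔷 × E))), IsOpen W ∧
      (((0 : 𝔷), χ 1), ((0 : 𝔷), χ 1)) ∈ W ∧ LCSmoothOn W μ ∧
      μ ((0, χ 1), (0, χ 1)) = (0, χ 1) ∧
      ∀ p ∈ W, bandClass c (p.1.1, χ.symm p.1.2) * bandClass c (p.2.1, χ.symm p.2.2) =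
        bandClass c ((μ p).1, χ.symm (μ p).2) := by
    let P : (𝔷 × E) × (𝔷 × E) →L[ℝ] E × E :=
      (ContinuousLinearMap.snd ℝ 𝔷 E).prodMap (ContinuousLinearMap.snd ℝ 𝔷 E)
    let Q : (𝔷 × E) × (𝔷 × E) →L[ℝ] 𝔷 :=
      (ContinuousLinearMap.fst ℝ 𝔷 E).coprod (ContinuousLinearMap.fst ℝ 𝔷 E)
    have hO : IsOpen (P ⁻¹' (WF ∩ Wm)) := (hWF.inter hWm).preimage P.continuous
    refine ⟨fun p => (p.1.1 + p.2.1 + c.F (χ.symm p.1.2) (χ.symm p.2.2),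
      χ (χ.symm p.1.2 * χ.symm p.2.2)), P ⁻¹' (WF ∩ Wm), hO, ⟨h1WF, h1Wm⟩, ?_, ?_, ?_⟩
    · refine LCSmoothOn.prodMk ((LCSmoothOn.clm _ Q).add ?_) ?_
      · exact hsF.comp (LCSmoothOn.clm _ P) hO hWF fun y hy => hy.1
      · exact hsm.comp (LCSmoothOn.clm _ P) hO hWm fun y hy => hy.2
    · simp [hχ1, c.F_one_left]
    · intro p hp
      rw [bandClass_mul]
      simp only
      have h : χ.symm (χ (χ.symm p.1.2 * χ.symm p.2.2)) = χ.symm p.1.2 * χ.symm p.2.2 :=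
        χ.left_inv (hWmt _ hp.2).2.2
      rw [h]
  have hi : ∃ (ι : 𝔷 × E → 𝔷 × E) (W : Set (𝔷 × E)), IsOpen W ∧ ((0 : 𝔷), χ 1) ∈ W ∧
      LCSmoothOn W ι ∧ ι (0, χ 1) = (0, χ 1) ∧
      ∀ p ∈ W, (bandClass c (p.1, χ.symm p.2))⁻¹ = bandClass c ((ι p).1, χ.symm (ι p).2) := by
    have hic : ContinuousOn (fun y => (y, χ (χ.symm y)⁻¹)) Wi :=
      continuousOn_id.prodMk hsi.continuousOn
    -- The inverse contains `F(g, g⁻¹)`, so `(g, g⁻¹)` must stay where `F` is known to be smooth.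
    have hO : IsOpen (Wi ∩ (fun y => (y, χ (χ.symm y)⁻¹)) ⁻¹' WF) :=
      hic.isOpen_inter_preimage hWi hWF
    have hO' := hO.preimage (ContinuousLinearMap.snd ℝ 𝔷 E).continuous
    have hFi : LCSmoothOn (Wi ∩ (fun y => (y, χ (χ.symm y)⁻¹)) ⁻¹' WF)
        (fun y => c.F (χ.symm y) (χ.symm y)⁻¹) := by
      refine (hsF.comp ((LCSmoothOn.id _).prodMk (hsi.mono inter_subset_left)) hO hWF
        fun y hy => hy.2).congr hO fun y hy => ?_
      have := χ.left_inv (hWis y hy.1)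
      simp only [Function.comp_apply]
      show c.F _ _ = c.F _ (χ.symm (χ _))
      rw [this]
    refine ⟨fun p => (-p.1 + -c.F (χ.symm p.2) (χ.symm p.2)⁻¹, χ (χ.symm p.2)⁻¹), _, hO',
      ⟨h1Wi, ?_⟩, ?_, ?_, ?_⟩
    · show (χ 1, χ (χ.symm (χ 1))⁻¹) ∈ WF
      rw [hχ1, inv_one]
      exact h1WF
    · refine LCSmoothOn.prodMk ((LCSmoothOn.clm _ (-ContinuousLinearMap.fst ℝ 𝔷 E)).add
        (LCSmoothOn.neg ?_)) ?_
      · exact hFi.comp (LCSmoothOn.clm _ (ContinuousLinearMap.snd ℝ 𝔷 E)) hO' hO fun y hy => hy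
      · exact (hsi.mono inter_subset_left).comp
          (LCSmoothOn.clm _ (ContinuousLinearMap.snd ℝ 𝔷 E)) hO' hO fun y hy => hy
    · simp [hχ1, c.F_one_left]
    · intro p hp
      rw [bandClass_inv]
      simp only
      have h : χ.symm (χ (χ.symm p.2)⁻¹) = (χ.symm p.2)⁻¹ := χ.left_inv (hWis p.2 hp.1)
      rw [h, sub_eq_add_neg]
  have hgen : ∀ S : Subgroup (Band c), Subgroup.center (Band c) ≤ S →
      (∀ᶠ y in 𝓝 ((0 : 𝔷), χ 1), bandClass c (y.1, χ.symm y.2) ∈ S) → S = ⊤ := by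
    intro S hS hev
    -- The image of `S` in the connected group `G` contains a unit neighbourhood, so it is an open
    -- and closed subgroup, hence all of `G`. An element of the band thus differs from one of `S` by
    -- an element of the central kernel, which also lies in `S`.
    have hmap : (S.map (bandProj c) : Set G) ∈ 𝓝 (1 : G) := by
      have hc : ContinuousAt (fun g : G => ((0 : 𝔷), χ g)) 1 :=
        continuousAt_const.prodMk (χ.continuousAt (mem_chart_source E 1))
      filter_upwards [hc.eventually hev, χ.open_source.mem_nhds (mem_chart_source E 1)]
        with g hg hgs
      refine ⟨_, hg, ?_⟩
      rw [bandProj_apply]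
      exact χ.left_inv hgs
    have hopen := (S.map (bandProj c)).isOpen_of_mem_nhds hmap
    have huniv := IsClopen.eq_univ ⟨(S.map (bandProj c)).isClosed_of_isOpen hopen, hopen⟩
      ⟨1, one_mem _⟩
    rw [eq_top_iff]
    intro b _
    obtain ⟨k, hk, hkb⟩ : bandProj c b ∈ (S.map (bandProj c) : Set G) := by
      rw [huniv]; trivial
    have hker : k⁻¹ * b ∈ (bandProj c).ker := by
      rw [MonoidHom.mem_ker, map_mul, map_inv, hkb, inv_mul_cancel]
    rw [← bandIncl_range_eq_ker] at hker
    have := S.mul_mem hk (hS (bandIncl_range_le_center c hker))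
    rwa [mul_inv_cancel_left] at this
  obtain ⟨D, hD, hD1⟩ := exists_lieChart_of_injOn
    (fun y : 𝔷 × E => bandClass c (y.1, χ.symm y.2)) (hV.prod χ.open_target)
    (fun x hx y hy h => by
      obtain ⟨h1, h2⟩ := (bandClass_eq_iff c).1 h
      exact Prod.ext (hinj _ hx.1 _ hy.1 h1) (χ.symm.injOn hx.2 hy.2 h2))
    (o := (0, χ 1)) ⟨h0V, h1t⟩ (by rw [hχ1, bandClass_one]) hm hi hgen
  exact ⟨D, hD, hD1⟩

end Construction

/-! ### Product manifolds, charts as smooth maps, and descent along local diffeomorphisms -/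

section ChartMaps

variable {E E' E'' : Type*}
  [AddCommGroup E] [Module ℝ E] [TopologicalSpace E] [IsTopologicalAddGroup E]
  [ContinuousSMul ℝ E]
  [AddCommGroup E'] [Module ℝ E'] [TopologicalSpace E'] [IsTopologicalAddGroup E']
  [ContinuousSMul ℝ E']
  [AddCommGroup E''] [Module ℝ E''] [TopologicalSpace E''] [IsTopologicalAddGroup E'']
  [ContinuousSMul ℝ E'']
  {M N P : Type*} [TopologicalSpace M] [TopologicalSpace N] [TopologicalSpace P]
  [ChartedSpace E M] [ChartedSpace E' N] [ChartedSpace E'' P]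

instance lcManifoldProd [LocallyConvexSpace ℝ E] [LocallyConvexSpace ℝ E']
    [LCManifold E M] [LCManifold E' N] : LCManifold (E × E') (M × N) where
  t2 := by
    have := LCManifold.t2 (E := E) (M := M)
    have := LCManifold.t2 (E := E') (M := N)
    infer_instance
  smooth_coordChange := by
    rintro _ ⟨e₁, he₁, e₂, he₂, rfl⟩ _ ⟨f₁, hf₁, f₂, hf₂, rfl⟩
    have h₁ := LCManifold.smooth_coordChange (E := E) e₁ he₁ f₁ hf₁
    have h₂ := LCManifold.smooth_coordChange (E := E') e₂ he₂ f₂ hf₂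
    have ho₁ := (e₁.symm.trans f₁).open_source
    have ho₂ := (e₂.symm.trans f₂).open_source
    have ho := ho₁.prod ho₂
    have h := (h₁.comp (LCSmoothOn.clm _ (ContinuousLinearMap.fst ℝ E E')) ho ho₁
      fun p hp => hp.1).prodMk
      (h₂.comp (LCSmoothOn.clm _ (ContinuousLinearMap.snd ℝ E E')) ho ho₂ fun p hp => hp.2)
    exact (h.mono fun p hp => ⟨⟨hp.1.1, hp.2.1⟩, ⟨hp.1.2, hp.2.2⟩⟩).congr
      ((e₁.prod e₂).symm.trans (f₁.prod f₂)).open_source fun p _ => rfl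

theorem lcSmoothAt_chartAt (p : M) : LCSmoothAt E E (chartAt E p) p := by
  rw [lcSmoothAt_iff]
  refine ⟨_, (chartAt E p).open_target, (chartAt E p).map_source (mem_chart_source E p), subset_rfl,
    fun y hy => trivial, ?_⟩
  refine (LCSmoothOn.id _).congr (chartAt E p).open_target fun y hy => ?_
  exact (chartAt E p).right_inv hy

theorem lcSmoothAt_chartAt_symm (p : M) : LCSmoothAt E E (chartAt E p).symm (chartAt E p p) := by
  rw [lcSmoothAt_iff]
  rw [(chartAt E p).left_inv (mem_chart_source E p)]
  refine ⟨_, (chartAt E p).open_target, (chartAt E p).map_source (mem_chart_source E p),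
    subset_univ _, fun y hy => (chartAt E p).map_target hy, ?_⟩
  refine (LCSmoothOn.id _).congr (chartAt E p).open_target fun y hy => ?_
  exact (chartAt E p).right_inv hy

/-- The composition of smooth maps through a vector space. -/
theorem LCSmoothAt.comp_self [LocallyConvexSpace ℝ E''] {f : M → E'} {g : E' → P} {p : M}
    (hg : LCSmoothAt E' E'' g (f p)) (hf : LCSmoothAt E E' f p) :
    LCSmoothAt E E'' (fun x => g (f x)) p := hg.comp hf

/-- For maps to a product of vector spaces, the product of the vector spaces may be regarded as a
vector space. -/
theorem LCSmoothAt.prodMk_self {f : M → E'} {g : M → E''} {p : M} (hf : LCSmoothAt E E' f p)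
    (hg : LCSmoothAt E E'' g p) :
    @LCSmoothAt E (E' × E'') _ _ _ _ _ _ M (E' × E'') _ _ _ (chartedSpaceSelf _)
      (fun x => (f x, g x)) p := hf.prodMk hg

/-- A map is smooth if its composition with a local diffeomorphism is. -/
theorem IsLCLocalDiffeoAt.lcSmoothAt_of_comp [LocallyConvexSpace ℝ E''] {f : M → N} {p : M}
    (hf : IsLCLocalDiffeoAt E E' f p) {h : N → P} {k : M → P} (hk : LCSmoothAt E E'' k p)
    (hhf : ∀ x, h (f x) = k x) : LCSmoothAt E' E'' h (f p) := by
  obtain ⟨-, j, hj, hjp, hfj⟩ := hf.exists_local_inverse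
  have h1 : LCSmoothAt E' E'' (fun y => k (j y)) (f p) := LCSmoothAt.comp (by rwa [hjp]) hj
  refine h1.congr ?_
  filter_upwards [hfj] with y hy
  rw [← hhf, hy]

end ChartMaps

/-! ### The unit chart of the constructed Lie group -/

section LieChartMaps

variable {E : Type*} [AddCommGroup E] [Module ℝ E] [TopologicalSpace E] [IsTopologicalAddGroup E]
  [ContinuousSMul ℝ E] [LocallyConvexSpace ℝ E] [T2Space E] {B : Type*} [Group B]

namespace LieChart

variable (D : LieChart E B)

theorem chartAt_one_apply (b : D.lieStructure.Carrier) :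
    chartAt E (1 : D.lieStructure.Carrier) b = D.unitChart b := by
  rw [chartAt_apply, inv_one, one_mul]

theorem chartAt_one_symm_apply (y : E) :
    (chartAt E (1 : D.lieStructure.Carrier)).symm y = D.unitChart.symm y := by
  rw [chartAt_symm_apply, one_mul]

theorem lcSmoothAt_unitChart : LCSmoothAt E E D.unitChart 1 :=
  (lcSmoothAt_chartAt (E := E) (1 : D.lieStructure.Carrier)).congr
    (Eventually.of_forall D.chartAt_one_apply)

theorem lcSmoothAt_unitChart_symm : LCSmoothAt E E D.unitChart.symm (D.unitChart 1) := by
  have h := lcSmoothAt_chartAt_symm (E := E) (1 : D.lieStructure.Carrier)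
  rw [chartAt_one_apply] at h
  exact h.congr (Eventually.of_forall D.chartAt_one_symm_apply)

theorem eventually_mem_source :
    ∀ᶠ b in 𝓝 (1 : D.lieStructure.Carrier), b ∈ D.unitChart.source := by
  have h := (chartAt E (1 : D.lieStructure.Carrier)).open_source.mem_nhds (mem_chart_source E 1)
  filter_upwards [h] with b hb
  rwa [mem_chartAt_source, inv_one, one_mul] at hb

theorem eventually_mem_target : ∀ᶠ y in 𝓝 (D.unitChart 1), y ∈ D.unitChart.target :=
  D.open_unitChart_target.mem_nhds D.unitChart_one_mem

end LieChart

end LieChartMaps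

/-! ### Smoothness of the structure maps of the band -/

section Quotient

variable {𝔷 A : Type*} [AddCommGroup 𝔷] [Module ℝ 𝔷] [TopologicalSpace 𝔷]
  [IsTopologicalAddGroup 𝔷] [ContinuousSMul ℝ 𝔷] [LocallyConvexSpace ℝ 𝔷] [T2Space 𝔷]
  [AddCommGroup A] {τ : A →+ 𝔷}

theorem quotMap_add (S : LieStructure 𝔷 (Multiplicative (𝔷 ⧸ τ.range))) (x y : 𝔷) :
    quotMap S (x + y) = quotMap S x * quotMap S y := rfl

theorem quotMap_zero (S : LieStructure 𝔷 (Multiplicative (𝔷 ⧸ τ.range))) :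
    quotMap S 0 = 1 := rfl

theorem quotMap_surjective (S : LieStructure 𝔷 (Multiplicative (𝔷 ⧸ τ.range))) :
    Function.Surjective (quotMap S) := QuotientAddGroup.mk_surjective

/-- Locally the identity is the quotient map for one structure composed with a local inverse of the
quotient map for the other. -/
theorem IsNaturalOnQuotient.coincide {S S' : LieStructure 𝔷 (Multiplicative (𝔷 ⧸ τ.range))}
    (hS : IsNaturalOnQuotient S) (hS' : IsNaturalOnQuotient S') : S.Coincide S' := by
  constructor
  · intro b
    obtain ⟨x, rfl⟩ := quotMap_surjective S b
    exact (hS x).lcSmoothAt_of_comp (hS' x).exists_local_inverse.1 fun _ => rfl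
  · intro b
    obtain ⟨x, rfl⟩ := quotMap_surjective S' b
    exact (hS' x).lcSmoothAt_of_comp (hS x).exists_local_inverse.1 fun _ => rfl

variable {D : LieChart 𝔷 (Multiplicative (𝔷 ⧸ τ.range))}

/-- At `0` the quotient map is the inverse of the unit chart; elsewhere it is a translate of this.
-/
theorem lcSmooth_quotMap
    (hD : ∀ y, D.unitChart.symm y = quotMap D.lieStructure y) (hD1 : D.unitChart 1 = 0) :
    LCSmooth 𝔷 𝔷 (quotMap D.lieStructure) := by
  intro x
  have h0 : LCSmoothAt 𝔷 𝔷 (quotMap D.lieStructure) 0 := by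
    have h := D.lcSmoothAt_unitChart_symm
    rw [hD1] at h
    exact h.congr (Eventually.of_forall hD)
  have h1 : LCSmoothAt 𝔷 𝔷 (fun y => y + -x) x :=
    (LCSmoothOn.affine univ (ContinuousLinearMap.id ℝ 𝔷) (-x)).lcSmoothAt isOpen_univ trivial
  have h2 : LCSmoothAt 𝔷 𝔷 (fun y => quotMap D.lieStructure (y + -x)) x :=
    LCSmoothAt.comp (by rwa [add_neg_cancel]) h1
  refine (h2.const_mul (quotMap D.lieStructure x)).congr (Eventually.of_forall fun y => ?_)
  show quotMap D.lieStructure x * quotMap D.lieStructure (y + -x) = _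
  rw [← quotMap_add]
  congr 1
  abel

/-- The local inverse at the class of `x` is `b ↦ x + chart ([-x] * b)`, the unit chart moved by
translations. -/
theorem isNaturalOnQuotient_lieStructure
    (hD : ∀ y, D.unitChart.symm y = quotMap D.lieStructure y) (hD1 : D.unitChart 1 = 0) :
    IsNaturalOnQuotient D.lieStructure := by
  intro x
  set S := D.lieStructure
  have hq := lcSmooth_quotMap hD hD1
  have hx : quotMap S (-x) * quotMap S x = 1 := by
    rw [← quotMap_add, neg_add_cancel, quotMap_zero]
  have hmul : LCSmoothAt 𝔷 𝔷 (fun b : S.Carrier => quotMap S (-x) * b) (quotMap S x) :=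
    (LCSmoothAt.id _).const_mul _
  refine isLCLocalDiffeoAt_of_local_inverse
    (j := fun b => x + D.unitChart (quotMap S (-x) * b : S.Carrier))
    (Eventually.of_forall hq) ?_ ?_ ?_
  · have h1 : LCSmoothAt 𝔷 𝔷 (fun b : S.Carrier => D.unitChart (quotMap S (-x) * b : S.Carrier))
        (quotMap S x) :=
      LCSmoothAt.comp (g := fun b : S.Carrier => D.unitChart b)
        (by rw [hx]; exact D.lcSmoothAt_unitChart) hmul
    have h2 : LCSmoothAt 𝔷 𝔷 (fun y => x + y) (D.unitChart (quotMap S (-x) * quotMap S x : S.Carrier)) :=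
      ((LCSmoothOn.const univ x).add (LCSmoothOn.id univ)).lcSmoothAt isOpen_univ trivial
    exact (LCSmoothAt.comp (f := fun b : S.Carrier => D.unitChart (quotMap S (-x) * b : S.Carrier))
      (g := fun y => x + y) h2 h1).eventually
  · have hc : ContinuousAt (fun y : 𝔷 => -x + y) x := by fun_prop
    have hev := D.eventually_mem_target
    rw [hD1, ← neg_add_cancel x] at hev
    filter_upwards [hc.eventually hev] with y hy
    have h1 : (quotMap S (-x) * quotMap S y : S.Carrier) = D.unitChart.symm (-x + y) := by
      rw [← quotMap_add, hD]
    rw [h1, D.unitChart.right_inv hy, add_neg_cancel_left]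
  · have hev := D.eventually_mem_source
    rw [← hx] at hev
    filter_upwards [hmul.1.eventually hev] with b hb
    have h1 : quotMap S (D.unitChart (quotMap S (-x) * b : S.Carrier)) = quotMap S (-x) * b :=
      (hD _).symm.trans (D.unitChart.left_inv hb)
    rw [quotMap_add, h1, ← mul_assoc, ← quotMap_add, add_neg_cancel, quotMap_zero, one_mul]

end Quotient

/-! ### Smoothness of the band's structure maps, uniqueness, and the principal bundle -/

section BandMaps

variable {E 𝔷 A G : Type*}
  [AddCommGroup E] [Module ℝ E] [TopologicalSpace E] [IsTopologicalAddGroup E]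
  [ContinuousSMul ℝ E] [LocallyConvexSpace ℝ E] [T2Space E]
  [AddCommGroup 𝔷] [Module ℝ 𝔷] [TopologicalSpace 𝔷]
  [IsTopologicalAddGroup 𝔷] [ContinuousSMul ℝ 𝔷] [LocallyConvexSpace ℝ 𝔷] [T2Space 𝔷]
  [AddCommGroup A] [Group G] [TopologicalSpace G] [ChartedSpace E G] [LCLieGroup E G]
  {τ : A →+ 𝔷} {c : GenCocycle τ G}

theorem bandClassMap_one (T : LieStructure (𝔷 × E) (Band c)) : bandClassMap T (0, 1) = 1 :=
  bandClass_one c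

theorem bandProjLie_bandClassMap (T : LieStructure (𝔷 × E) (Band c)) (p : 𝔷 × G) :
    bandProjLie T (bandClassMap T p) = p.2 := bandProj_apply c p

theorem bandInclLie_quotMap (S : LieStructure 𝔷 (Multiplicative (𝔷 ⧸ τ.range)))
    (T : LieStructure (𝔷 × E) (Band c)) (x : 𝔷) :
    bandInclLie S T (quotMap S x) = bandClassMap T (x, 1) := bandIncl_apply c x

/-- The map `[(x, g)] ↦ [x]`, between the Lie groups. -/
def bandFibreCoordLie (S : LieStructure 𝔷 (Multiplicative (𝔷 ⧸ τ.range)))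
    (T : LieStructure (𝔷 × E) (Band c)) : T.Carrier → S.Carrier := bandFibreCoord c

theorem bandFibreCoordLie_bandClassMap (S : LieStructure 𝔷 (Multiplicative (𝔷 ⧸ τ.range)))
    (T : LieStructure (𝔷 × E) (Band c)) (p : 𝔷 × G) :
    bandFibreCoordLie S T (bandClassMap T p) = quotMap S p.1 := rfl

theorem bandFibreCoordLie_incl (S : LieStructure 𝔷 (Multiplicative (𝔷 ⧸ τ.range)))
    (T : LieStructure (𝔷 × E) (Band c)) (h : S.Carrier) :
    bandFibreCoordLie S T (bandInclLie S T h) = h := bandFibreCoord_incl c h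

theorem bandFibreCoordLie_incl_mul (S : LieStructure 𝔷 (Multiplicative (𝔷 ⧸ τ.range)))
    (T : LieStructure (𝔷 × E) (Band c)) (h : S.Carrier) (b : T.Carrier) :
    bandFibreCoordLie S T (bandInclLie S T h * b) = h * bandFibreCoordLie S T b :=
  bandFibreCoord_incl_mul c h b

theorem bandInclLie_bandFibreCoordLie (S : LieStructure 𝔷 (Multiplicative (𝔷 ⧸ τ.range)))
    (T : LieStructure (𝔷 × E) (Band c)) {b : T.Carrier} (hb : bandProjLie T b = 1) :
    bandInclLie S T (bandFibreCoordLie S T b) = b := bandIncl_bandFibreCoord c hb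

theorem bandProjLie_bandInclLie (S : LieStructure 𝔷 (Multiplicative (𝔷 ⧸ τ.range)))
    (T : LieStructure (𝔷 × E) (Band c)) (h : S.Carrier) :
    bandProjLie T (bandInclLie S T h) = 1 := bandProj_bandIncl c h

/-- The local diffeomorphism property is available only at the unit object, and gives smoothness of
the identity there. As the identity is a homomorphism, it is smooth everywhere. -/
theorem IsNaturalOnBand.coincide {T T' : LieStructure (𝔷 × E) (Band c)}
    (hT : IsNaturalOnBand T) (hT' : IsNaturalOnBand T') : T.Coincide T' := by
  have key : ∀ {T T' : LieStructure (𝔷 × E) (Band c)}, IsNaturalOnBand T → IsNaturalOnBand T' →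
      LCSmooth (𝔷 × E) (𝔷 × E) (T.idMap T') := by
    intro T T' hT hT'
    let φ : T.Carrier →* T'.Carrier := MonoidHom.id (Band c)
    have h : LCSmoothAt (𝔷 × E) (𝔷 × E) (T.idMap T') (bandClassMap T (0, 1)) :=
      IsLCLocalDiffeoAt.lcSmoothAt_of_comp hT (IsLCLocalDiffeoAt.exists_local_inverse hT').1
        fun _ => rfl
    rw [bandClassMap_one] at h
    exact LCSmooth.of_hom φ h
  exact ⟨key hT hT', key hT' hT⟩

variable {DS : LieChart 𝔷 (Multiplicative (𝔷 ⧸ τ.range))} {DT : LieChart (𝔷 × E) (Band c)}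
  (hS : ∀ y, DS.unitChart.symm y = quotMap DS.lieStructure y) (hS1 : DS.unitChart 1 = 0)
  (hT : ∀ y, DT.unitChart.symm y =
    bandClassMap DT.lieStructure (y.1, (chartAt E (1 : G)).symm y.2))
  (hT1 : DT.unitChart 1 = (0, chartAt E (1 : G) 1))

include hT hT1 in
-- Near `(0, 1)` this is the inverse unit chart of the band after the chart of `G`.
theorem lcSmoothAt_bandClassMap :
    LCSmoothAt (𝔷 × E) (𝔷 × E) (bandClassMap DT.lieStructure) (0, 1) := by
  have h1 := (lcSmoothAt_fst (E := 𝔷) (E' := E) ((0 : 𝔷), (1 : G))).prodMk_self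
    (LCSmoothAt.comp (g := chartAt E (1 : G))
      (lcSmoothAt_chartAt (E := E) (1 : G)) (lcSmoothAt_snd ((0 : 𝔷), (1 : G))))
  have h2 := DT.lcSmoothAt_unitChart_symm
  rw [hT1] at h2
  refine (LCSmoothAt.comp_self (f := fun p : 𝔷 × G => (p.1, chartAt E (1 : G) p.2)) h2 h1).congr ?_
  have ho : univ ×ˢ (chartAt E (1 : G)).source ∈ 𝓝 ((0 : 𝔷), (1 : G)) :=
    (isOpen_univ.prod (chartAt E (1 : G)).open_source).mem_nhds ⟨trivial, mem_chart_source E 1⟩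
  filter_upwards [ho] with p hp
  rw [hT, (chartAt E (1 : G)).left_inv hp.2]

theorem eventually_bandClassMap_unitChart
    (hT : ∀ y, DT.unitChart.symm y =
      bandClassMap DT.lieStructure (y.1, (chartAt E (1 : G)).symm y.2)) :
    ∀ᶠ b in 𝓝 (1 : DT.lieStructure.Carrier), bandClassMap DT.lieStructure
      ((DT.unitChart b).1, (chartAt E (1 : G)).symm (DT.unitChart b).2) = b := by
  filter_upwards [DT.eventually_mem_source] with b hb
  rw [← hT, DT.unitChart.left_inv hb]

theorem lcSmoothAt_unitChart_fst :
    LCSmoothAt (𝔷 × E) 𝔷 (fun b => (DT.unitChart b).1) (1 : DT.lieStructure.Carrier) :=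
  LCSmoothAt.comp_self (((LCSmoothOn.clm univ (ContinuousLinearMap.fst ℝ 𝔷 E))).lcSmoothAt isOpen_univ
    trivial) DT.lcSmoothAt_unitChart

theorem lcSmoothAt_unitChart_snd
    (hT1 : DT.unitChart 1 = (0, chartAt E (1 : G) 1)) :
    LCSmoothAt (𝔷 × E) E (fun b => (chartAt E (1 : G)).symm (DT.unitChart b).2)
      (1 : DT.lieStructure.Carrier) := by
  have h : LCSmoothAt (𝔷 × E) E (fun b => (DT.unitChart b).2) (1 : DT.lieStructure.Carrier) :=
    LCSmoothAt.comp_self (((LCSmoothOn.clm univ (ContinuousLinearMap.snd ℝ 𝔷 E))).lcSmoothAt isOpen_univ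
      trivial) DT.lcSmoothAt_unitChart
  refine LCSmoothAt.comp (g := (chartAt E (1 : G)).symm) ?_ h
  rw [hT1]
  exact lcSmoothAt_chartAt_symm (E := E) (1 : G)

include hT hT1 in
theorem isNaturalOnBand_lieStructure : IsNaturalOnBand DT.lieStructure := by
  have hj := (lcSmoothAt_unitChart_fst (DT := DT)).prodMk (lcSmoothAt_unitChart_snd hT1)
  refine isLCLocalDiffeoAt_of_local_inverse (lcSmoothAt_bandClassMap hT hT1).eventually
    (j := fun b => ((DT.unitChart b).1, (chartAt E (1 : G)).symm (DT.unitChart b).2)) ?_ ?_ ?_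
  · rw [bandClassMap_one]
    exact hj.eventually
  · have hc : ContinuousAt (fun p : 𝔷 × G => (p.1, chartAt E (1 : G) p.2)) (0, 1) :=
      continuousAt_fst.prodMk (ContinuousAt.comp (g := chartAt E (1 : G))
        ((chartAt E (1 : G)).continuousAt (mem_chart_source E 1)) continuousAt_snd)
    have hev := DT.eventually_mem_target
    rw [hT1] at hev
    have ho : univ ×ˢ (chartAt E (1 : G)).source ∈ 𝓝 ((0 : 𝔷), (1 : G)) :=
      (isOpen_univ.prod (chartAt E (1 : G)).open_source).mem_nhds ⟨trivial, mem_chart_source E 1⟩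
    filter_upwards [hc.eventually hev, ho] with p hp hps
    have h1 : DT.unitChart (bandClassMap DT.lieStructure p) = (p.1, chartAt E (1 : G) p.2) := by
      rw [← DT.unitChart.right_inv hp, hT, (chartAt E (1 : G)).left_inv hps.2]
    rw [h1]
    exact Prod.ext rfl ((chartAt E (1 : G)).left_inv hps.2)
  · rw [bandClassMap_one]
    exact eventually_bandClassMap_unitChart hT

include hS hS1 hT hT1 in
-- In the unit charts the inclusion is `y ↦ (y, χ 1)`, where `χ` is the chart of `G`; a homomorphism
-- need only be checked at the unit.
theorem lcSmooth_bandInclLie :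
    LCSmooth 𝔷 (𝔷 × E) (bandInclLie DS.lieStructure DT.lieStructure) := by
  refine LCSmooth.of_hom _ ?_
  have h1 := (DS.lcSmoothAt_unitChart).prodMk_self
    (LCSmoothAt.const (chartAt E (1 : G) 1) (1 : DS.lieStructure.Carrier))
  have h2 := DT.lcSmoothAt_unitChart_symm
  rw [hT1, ← hS1] at h2
  refine (LCSmoothAt.comp_self (f := fun b : DS.lieStructure.Carrier =>
    (DS.unitChart b, chartAt E (1 : G) 1)) h2 h1).congr ?_
  filter_upwards [DS.eventually_mem_source] with b hb
  rw [hT, (chartAt E (1 : G)).left_inv (mem_chart_source E 1),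
    ← bandInclLie_quotMap DS.lieStructure, ← hS, DS.unitChart.left_inv hb]

include hT hT1 in
theorem lcSmooth_bandProjLie : LCSmooth (𝔷 × E) E (bandProjLie DT.lieStructure) := by
  refine LCSmooth.of_hom _ ((lcSmoothAt_unitChart_snd hT1).congr ?_)
  filter_upwards [eventually_bandClassMap_unitChart hT] with b hb
  conv_rhs => rw [← hb, bandProjLie_bandClassMap]

include hT hT1 in
theorem lcSmoothAt_section :
    LCSmoothAt E (𝔷 × E) (fun g : G => bandClassMap DT.lieStructure (0, g)) 1 :=
  LCSmoothAt.comp (f := fun g : G => ((0 : 𝔷), g)) (lcSmoothAt_bandClassMap hT hT1)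
    ((LCSmoothAt.const (0 : 𝔷) (1 : G)).prodMk (LCSmoothAt.id (1 : G)))

include hS hS1 hT hT1 in
-- Near the unit the fibre coordinate is the class of the first chart component, and equivariance
-- carries this along the central fibre. No smoothness is claimed over other points of `G`, where
-- `F` is not controlled.
theorem lcSmoothAt_bandFibreCoordLie (h : DS.lieStructure.Carrier) :
    LCSmoothAt (𝔷 × E) 𝔷 (bandFibreCoordLie DS.lieStructure DT.lieStructure)
      (bandInclLie DS.lieStructure DT.lieStructure h) := by
  have h0 : LCSmoothAt (𝔷 × E) 𝔷 (bandFibreCoordLie DS.lieStructure DT.lieStructure) 1 := by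
    refine (LCSmoothAt.comp (lcSmooth_quotMap hS hS1 _)
      (lcSmoothAt_unitChart_fst (DT := DT))).congr ?_
    filter_upwards [eventually_bandClassMap_unitChart hT] with b hb
    conv_rhs => rw [← hb, bandFibreCoordLie_bandClassMap]
  have h1 : LCSmoothAt (𝔷 × E) 𝔷 (fun b => bandFibreCoordLie DS.lieStructure DT.lieStructure
      (bandInclLie DS.lieStructure DT.lieStructure h⁻¹ * b))
      (bandInclLie DS.lieStructure DT.lieStructure h) :=
    LCSmoothAt.comp (by rwa [← map_mul, inv_mul_cancel, map_one])
      ((LCSmoothAt.id (E := 𝔷 × E) _).const_mul _)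
  refine (h1.const_mul h).congr (Eventually.of_forall fun b => ?_)
  show h * bandFibreCoordLie DS.lieStructure DT.lieStructure _ = _
  rw [bandFibreCoordLie_incl_mul, mul_inv_cancel_left]

include hS hS1 hT hT1 in
theorem isCentralLieExtension_band :
    IsCentralLieExtension 𝔷 (𝔷 × E) E (bandInclLie DS.lieStructure DT.lieStructure)
      (bandProjLie DT.lieStructure) where
  injective := bandIncl_injective c
  exact := bandIncl_range_eq_ker c
  surjective := bandProj_surjective c
  central := bandIncl_range_le_center c
  smooth_incl := lcSmooth_bandInclLie hS hS1 hT hT1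
  smooth_proj := lcSmooth_bandProjLie hT hT1
  local_section := by
    obtain ⟨U, hU, hUo, h1U⟩ := eventually_nhds_iff.1 (lcSmoothAt_section hT hT1).eventually
    exact ⟨U, fun g => bandClassMap DT.lieStructure (0, g), hUo, h1U,
      fun u hu => ⟨hU u hu, bandProjLie_bandClassMap _ _⟩⟩

include hS hS1 hT hT1 in
theorem isSmoothPrincipalBundle_band :
    IsSmoothPrincipalBundle 𝔷 (𝔷 × E) E
      (fun (h : DS.lieStructure.Carrier) (b : DT.lieStructure.Carrier) =>
        bandInclLie DS.lieStructure DT.lieStructure h * b) (bandProjLie DT.lieStructure) where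
  one_act b := by rw [map_one, one_mul]
  mul_act h h' b := by rw [map_mul, mul_assoc]
  smooth_act p := LCSmoothAt.mul
    (LCSmoothAt.comp (lcSmooth_bandInclLie hS hS1 hT hT1 _) (lcSmoothAt_fst p)) (lcSmoothAt_snd p)
  smooth_proj := lcSmooth_bandProjLie hT hT1
  locally_trivial m := by
    have : IsTopologicalGroup G := LCLieGroup.isTopologicalGroup E
    obtain ⟨O, hO, hOo, h1O⟩ := eventually_nhds_iff.1 (lcSmoothAt_section hT hT1).eventually
    have hUo : IsOpen ((fun g : G => m⁻¹ * g) ⁻¹' O) := hOo.preimage (by fun_prop)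
    set S := DS.lieStructure
    set T := DT.lieStructure
    -- The section near `m` is a left translate of the section at the unit. The naive section `u ↦
    -- [(0, u)]` differs from it by the class of `F(m, m⁻¹ u)`, which need not be smooth.
    set s : G → T.Carrier := fun u => bandClassMap T (0, m) * bandClassMap T (0, m⁻¹ * u) with hs
    have hps : ∀ u, bandProjLie T (s u) = u := fun u => by
      rw [hs, map_mul, bandProjLie_bandClassMap, bandProjLie_bandClassMap, mul_inv_cancel_left]
    have hss : ∀ u ∈ (fun g : G => m⁻¹ * g) ⁻¹' O, LCSmoothAt E (𝔷 × E) s u := fun u hu =>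
      (LCSmoothAt.comp (f := fun g : G => m⁻¹ * g) (g := fun g : G => bandClassMap T (0, g))
        (hO _ hu) ((LCSmoothAt.id u).const_mul m⁻¹)).const_mul _
    have hpi := lcSmooth_bandProjLie hT hT1
    have hin := lcSmooth_bandInclLie hS hS1 hT hT1
    have hker : ∀ b, bandProjLie T (b * (s (bandProjLie T b))⁻¹) = 1 := fun b => by
      rw [map_mul, map_inv, hps, mul_inv_cancel]
    have hpφ : ∀ h u, bandProjLie T (bandInclLie S T h * s u) = u := fun h u => by
      rw [map_mul, bandProjLie_bandInclLie, one_mul, hps]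
    refine ⟨_, hUo, by rw [mem_preimage, inv_mul_cancel]; exact h1O,
      fun p => bandInclLie S T p.1 * s p.2,
      ⟨isOpen_univ.prod hUo, hUo.preimage (continuous_iff_continuousAt.2 fun b => (hpi b).1),
        -- Dividing `b` by the section over its base point leaves an element of the kernel, from
        -- which the fibre coordinate recovers `h`.
        fun b => (bandFibreCoordLie S T (b * (s (bandProjLie T b))⁻¹), bandProjLie T b),
        fun p hp => ?_, fun b hb => ⟨trivial, hb⟩, fun p hp => ?_, fun b hb => ?_, fun p hp => ?_,
        fun b hb => ?_⟩, fun h u _ => hpφ h u, fun h h' u _ => ?_⟩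
    · rw [mem_preimage, hpφ]
      exact hp.2
    · simp only [hpφ]
      rw [mul_inv_cancel_right, bandFibreCoordLie_incl]
    · simp only
      rw [bandInclLie_bandFibreCoordLie S T (hker b), inv_mul_cancel_right]
    · exact LCSmoothAt.mul (LCSmoothAt.comp (hin _) (lcSmoothAt_fst p))
        (LCSmoothAt.comp (hss _ hp.2) (lcSmoothAt_snd p))
    · have h1 : LCSmoothAt (𝔷 × E) (𝔷 × E) (fun b => b * (s (bandProjLie T b))⁻¹) b :=
        (LCSmoothAt.id b).mul (LCSmoothAt.comp (hss _ hb) (hpi b)).inv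
      -- The quotient `b * s⁻¹` lies in the image of the inclusion, exactly where the fibre
      -- coordinate is known to be smooth.
      have h2 := lcSmoothAt_bandFibreCoordLie hS hS1 hT hT1
        (bandFibreCoordLie S T (b * (s (bandProjLie T b))⁻¹))
      rw [bandInclLie_bandFibreCoordLie S T (hker b)] at h2
      exact (LCSmoothAt.comp (f := fun b => b * (s (bandProjLie T b))⁻¹) h2 h1).prodMk (hpi b)
    · simp only
      rw [map_mul, mul_assoc]

end BandMaps

/-! ### The Lie algebra of the band -/

section SecondOrder

variable {K E F H : Type*}
  [AddCommGroup K] [Module ℝ K] [TopologicalSpace K] [IsTopologicalAddGroup K]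
  [ContinuousSMul ℝ K]
  [AddCommGroup E] [Module ℝ E] [TopologicalSpace E] [IsTopologicalAddGroup E]
  [ContinuousSMul ℝ E]
  [AddCommGroup F] [Module ℝ F] [TopologicalSpace F] [IsTopologicalAddGroup F]
  [ContinuousSMul ℝ F] [LocallyConvexSpace ℝ F] [T2Space F]
  [AddCommGroup H] [Module ℝ H] [TopologicalSpace H] [IsTopologicalAddGroup H]
  [ContinuousSMul ℝ H] [LocallyConvexSpace ℝ H] [T2Space H]

theorem dirDeriv_dirDeriv_congr {f g : E → F} {x : E} (h : f =ᶠ[𝓝 x] g) (v : E) :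
    dirDeriv (fun y => dirDeriv f y v) x v = dirDeriv (fun y => dirDeriv g y v) x v :=
  dirDeriv_congr (h.eventually_nhds.mono fun _ hy => dirDeriv_congr hy v) v

/-- The second derivative of `x ↦ (Q x + f (P x), g (P x))`, for linear `P` and `Q`. -/
theorem dirDeriv_dirDeriv_clm_add_prodMk {W : Set E} (hW : IsOpen W) {f : E → F} {g : E → H}
    (hf : LCSmoothOn W f) (hg : LCSmoothOn W g) (P : K →L[ℝ] E) (Q : K →L[ℝ] F) {x : K}
    (hx : P x ∈ W) (v : K) :
    dirDeriv (fun y => dirDeriv (fun y => (Q y + f (P y), g (P y))) y v) x v =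
      (dirDeriv (fun y => dirDeriv f y (P v)) (P x) (P v),
        dirDeriv (fun y => dirDeriv g y (P v)) (P x) (P v)) := by
  have hO : IsOpen (P ⁻¹' W) := hW.preimage P.continuous
  have hfP : ∀ {f : E → F}, LCSmoothOn W f → LCSmoothOn (P ⁻¹' W) (fun y => f (P y)) :=
    fun hf => hf.comp (LCSmoothOn.clm _ P) hO hW fun _ hy => hy
  have hgP : ∀ {g : E → H}, LCSmoothOn W g → LCSmoothOn (P ⁻¹' W) (fun y => g (P y)) :=
    fun hg => hg.comp (LCSmoothOn.clm _ P) hO hW fun _ hy => hy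
  -- The linear part `Q` contributes the constant `Q v` to the first derivative and therefore
  -- nothing to the second.
  have h1 : ∀ y ∈ P ⁻¹' W, dirDeriv (fun y => (Q y + f (P y), g (P y))) y v =
      (Q v + dirDeriv f (P y) (P v), dirDeriv g (P y) (P v)) := fun y hy => by
    rw [((LCSmoothOn.clm _ Q).add (hfP hf)).dirDeriv_prodMk (hgP hg) hy, dirDeriv_comp_clm]
    have := dirDeriv_affine_add Q 0 (hfP hf) hy v
    simp only [add_zero] at this
    rw [this, dirDeriv_comp_clm]
  rw [dirDeriv_congr (eventually_of_mem (hO.mem_nhds hx) h1)]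
  have hf' := hf.dirDeriv hW (P v)
  have hg' := hg.dirDeriv hW (P v)
  rw [((LCSmoothOn.const _ (Q v)).add (hfP hf')).dirDeriv_prodMk (hgP hg') hx,
    dirDeriv_comp_clm (fun z => dirDeriv g z (P v))]
  have := dirDeriv_affine_add (0 : K →L[ℝ] F) (Q v) (hfP hf') hx v
  simp only [_root_.zero_apply, zero_add] at this
  rw [this, dirDeriv_comp_clm (fun z => dirDeriv f z (P v))]

end SecondOrder

/-! ### The bracket of the band and its comparison with the extension defined by the cocycle -/

section BandLieAlgebra

variable {E 𝔷 A G : Type*}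
  [AddCommGroup E] [Module ℝ E] [TopologicalSpace E] [IsTopologicalAddGroup E]
  [ContinuousSMul ℝ E] [LocallyConvexSpace ℝ E] [T2Space E]
  [AddCommGroup 𝔷] [Module ℝ 𝔷] [TopologicalSpace 𝔷]
  [IsTopologicalAddGroup 𝔷] [ContinuousSMul ℝ 𝔷] [LocallyConvexSpace ℝ 𝔷] [T2Space 𝔷]
  [AddCommGroup A] [Group G] [TopologicalSpace G] [ChartedSpace E G] [LCLieGroup E G]
  {τ : A →+ 𝔷} {c : GenCocycle τ G}
  {DS : LieChart 𝔷 (Multiplicative (𝔷 ⧸ τ.range))} {DT : LieChart (𝔷 × E) (Band c)}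
  (hS : ∀ y, DS.unitChart.symm y = quotMap DS.lieStructure y) (hS1 : DS.unitChart 1 = 0)
  (hT : ∀ y, DT.unitChart.symm y =
    bandClassMap DT.lieStructure (y.1, (chartAt E (1 : G)).symm y.2))
  (hT1 : DT.unitChart 1 = (0, chartAt E (1 : G) 1))

include hT hT1 in
-- In the unit chart the multiplication is `(Q + F ∘ P, m ∘ P)`, where `P` forgets the
-- `𝔷`-components and `Q` adds them. The second derivative does not see the linear map `Q`.
theorem taylorTwo_mul_band (hF : LCSmoothAt (E × E) 𝔷 (fun p : G × G => c.F p.1 p.2) 1)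
    (v : (𝔷 × E) × (𝔷 × E)) :
    taylorTwo ((𝔷 × E) × (𝔷 × E)) (𝔷 × E)
      (fun p : DT.lieStructure.Carrier × DT.lieStructure.Carrier => p.1 * p.2) 1 v =
    (taylorTwo (E × E) 𝔷 (fun p : G × G => c.F p.1 p.2) 1 (v.1.2, v.2.2),
      taylorTwo (E × E) E (fun p : G × G => p.1 * p.2) 1 (v.1.2, v.2.2)) := by
  set T := DT.lieStructure with hTdef
  set χ := chartAt E (1 : G) with hχ
  have hχ1 : χ.symm (χ 1) = 1 := χ.left_inv (mem_chart_source E 1)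
  obtain ⟨WF, hWF, h1WF, -, hsF⟩ := hF.exists_smoothOn_prod (q := (0 : 𝔷)) (c.F_one_left 1)
  obtain ⟨Wm, hWm, h1Wm, hWmt, hsm⟩ :=
    (LCLieGroup.smooth_mul (E := E) (1 : G × G)).exists_smoothOn_prod (q := (1 : G)) (one_mul 1)
  let P : (𝔷 × E) × (𝔷 × E) →L[ℝ] E × E :=
    (ContinuousLinearMap.snd ℝ 𝔷 E).prodMap (ContinuousLinearMap.snd ℝ 𝔷 E)
  let Q : (𝔷 × E) × (𝔷 × E) →L[ℝ] 𝔷 :=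
    (ContinuousLinearMap.fst ℝ 𝔷 E).coprod (ContinuousLinearMap.fst ℝ 𝔷 E)
  let f : E × E → 𝔷 := fun y => c.F (χ.symm y.1) (χ.symm y.2)
  let g : E × E → E := fun y => χ (χ.symm y.1 * χ.symm y.2)
  have hf : LCSmoothOn (WF ∩ Wm) f := hsF.mono inter_subset_left
  have hg : LCSmoothOn (WF ∩ Wm) g := hsm.mono inter_subset_right
  have hW := hWF.inter hWm
  have hbase : chartAt ((𝔷 × E) × (𝔷 × E)) (1 : T.Carrier × T.Carrier) 1 =
      ((0, χ 1), (0, χ 1)) := by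
    show (chartAt (𝔷 × E) (1 : T.Carrier) 1, chartAt (𝔷 × E) (1 : T.Carrier) 1) = _
    rw [DT.chartAt_one_apply, hT1]
  have hP : P ((0, χ 1), (0, χ 1)) ∈ WF ∩ Wm := ⟨h1WF, h1Wm⟩
  -- The formula holds only near the base point, where the product stays in the chart domains; this
  -- is enough for derivatives there.
  have hexpr : chartExpr ((𝔷 × E) × (𝔷 × E)) (𝔷 × E)
      (fun p : T.Carrier × T.Carrier => p.1 * p.2) 1 =ᶠ[𝓝 ((0, χ 1), (0, χ 1))]
      fun y => (Q y + f (P y), g (P y)) := by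
    have hcont : ContinuousAt (fun y => (Q y + f (P y), g (P y))) ((0, χ 1), (0, χ 1)) := by
      have hfc := ContinuousAt.comp (g := f) (hf.continuousOn.continuousAt (hW.mem_nhds hP))
        P.continuous.continuousAt
      have hgc := ContinuousAt.comp (g := g) (hg.continuousOn.continuousAt (hW.mem_nhds hP))
        P.continuous.continuousAt
      exact (Q.continuous.continuousAt.add hfc).prodMk hgc
    have hev := DT.eventually_mem_target
    have hval : (Q ((0, χ 1), (0, χ 1)) + f (P ((0, χ 1), (0, χ 1))),
        g (P ((0, χ 1), (0, χ 1)))) = DT.unitChart 1 := by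
      rw [hT1]
      simp [P, Q, f, g, hχ1, c.F_one_left]
    rw [← hval] at hev
    filter_upwards [hcont.eventually hev,
      P.continuous.continuousAt.preimage_mem_nhds (hW.mem_nhds hP)] with y hy hyW
    have h1 : DT.unitChart.symm y.1 * DT.unitChart.symm y.2 =
        DT.unitChart.symm (Q y + f (P y), g (P y)) := by
      rw [hT, hT, hT]
      have h2 : χ.symm (g (P y)) = χ.symm y.1.2 * χ.symm y.2.2 := χ.left_inv (hWmt _ hyW.2).2.2
      simp only
      rw [h2]
      exact bandClass_mul c _ _
    have h3 : chartExpr ((𝔷 × E) × (𝔷 × E)) (𝔷 × E)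
        (fun p : T.Carrier × T.Carrier => p.1 * p.2) 1 y =
        DT.unitChart ((1 * 1)⁻¹ * (1 * DT.unitChart.symm y.1 * (1 * DT.unitChart.symm y.2))) := rfl
    rw [h3, one_mul, one_mul, one_mul, inv_one, one_mul, h1, DT.unitChart.right_inv hy]
  have hgm : chartExpr (E × E) E (fun p : G × G => p.1 * p.2) 1 = g := by
    have h1 : (1 : G × G).1 * (1 : G × G).2 = 1 := one_mul 1
    unfold chartExpr
    simp only [h1]
    rfl
  unfold taylorTwo
  rw [hbase, dirDeriv_dirDeriv_congr hexpr, dirDeriv_dirDeriv_clm_add_prodMk hW hf hg P Q hP, hgm]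
  rfl

include hT hT1 in
theorem lieAlgBracket_band (hF : LCSmoothAt (E × E) 𝔷 (fun p : G × G => c.F p.1 p.2) 1)
    (p q : 𝔷 × E) : lieAlgBracket (𝔷 × E) DT.lieStructure.Carrier p q =
      (c.derived E p.2 q.2, lieAlgBracket E G p.2 q.2) := by
  unfold lieAlgBracket GenCocycle.derived antisymTaylor
  rw [taylorTwo_mul_band hT hT1 hF, taylorTwo_mul_band hT hT1 hF]
  rfl

include hS hS1 in
theorem tangentAt_quotMap (z : 𝔷) : tangentAt 𝔷 𝔷 (quotMap DS.lieStructure) 0 z = z := by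
  unfold tangentAt
  have h : chartExpr 𝔷 𝔷 (quotMap DS.lieStructure) 0 =ᶠ[𝓝 0]
      fun y => ContinuousLinearMap.id ℝ 𝔷 y + 0 := by
    have hev := DS.eventually_mem_target
    rw [hS1] at hev
    filter_upwards [hev] with y hy
    show DS.unitChart ((quotMap DS.lieStructure 0)⁻¹ * quotMap DS.lieStructure y) = _
    rw [quotMap_zero, inv_one, one_mul, ← hS, DS.unitChart.right_inv hy]
    simp
  exact (dirDeriv_congr h z).trans (dirDeriv_affine _ _ _ _)

include hS hS1 hT hT1 in
theorem tangentAt_bandInclLie (z : 𝔷) :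
    tangentAt 𝔷 (𝔷 × E) (bandInclLie DS.lieStructure DT.lieStructure) 1 z = (z, 0) := by
  unfold tangentAt
  have h : chartExpr 𝔷 (𝔷 × E) (bandInclLie DS.lieStructure DT.lieStructure) 1 =ᶠ[𝓝 0]
      fun y => ContinuousLinearMap.inl ℝ 𝔷 E y + (0, chartAt E (1 : G) 1) := by
    have hc : ContinuousAt (fun y : 𝔷 => (y, chartAt E (1 : G) 1)) 0 := by fun_prop
    have hev := DT.eventually_mem_target
    rw [hT1] at hev
    filter_upwards [hc.eventually hev] with y hy
    show DT.unitChart ((bandInclLie DS.lieStructure DT.lieStructure 1)⁻¹ *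
      bandInclLie DS.lieStructure DT.lieStructure (1 * DS.unitChart.symm y)) = _
    have h1 := hT (y, chartAt E (1 : G) 1)
    rw [(chartAt E (1 : G)).left_inv (mem_chart_source E 1),
      ← bandInclLie_quotMap DS.lieStructure, ← hS] at h1
    rw [map_one, inv_one, one_mul, one_mul, ← h1, DT.unitChart.right_inv hy]
    simp
  rw [DS.chartAt_one_apply, hS1]
  exact (dirDeriv_congr h z).trans (dirDeriv_affine _ _ _ _)

include hT hT1 in
theorem tangentAt_bandProjLie (p : 𝔷 × E) :
    tangentAt (𝔷 × E) E (bandProjLie DT.lieStructure) 1 p = p.2 := by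
  unfold tangentAt
  have h : chartExpr (𝔷 × E) E (bandProjLie DT.lieStructure) 1 =ᶠ[𝓝 (0, chartAt E (1 : G) 1)]
      fun y => ContinuousLinearMap.snd ℝ 𝔷 E y + 0 := by
    have ho : univ ×ˢ (chartAt E (1 : G)).target ∈ 𝓝 ((0 : 𝔷), chartAt E (1 : G) 1) :=
      (isOpen_univ.prod (chartAt E (1 : G)).open_target).mem_nhds
        ⟨trivial, (chartAt E (1 : G)).map_source (mem_chart_source E 1)⟩
    filter_upwards [ho] with y hy
    show chartAt E (bandProjLie DT.lieStructure 1)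
      (bandProjLie DT.lieStructure (1 * DT.unitChart.symm y)) = _
    rw [map_one, one_mul, hT, bandProjLie_bandClassMap, (chartAt E (1 : G)).right_inv hy.2]
    simp
  rw [DT.chartAt_one_apply, hT1]
  exact (dirDeriv_congr h p).trans (dirDeriv_affine _ _ _ _)

/-- The shear `(z, x) ↦ (z + b x, x)` of a product. -/
def shearEquiv (b : E →L[ℝ] 𝔷) : (𝔷 × E) ≃L[ℝ] (𝔷 × E) :=
  ContinuousLinearEquiv.equivOfInverse
    ((ContinuousLinearMap.fst ℝ 𝔷 E + b.comp (ContinuousLinearMap.snd ℝ 𝔷 E)).prod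
      (ContinuousLinearMap.snd ℝ 𝔷 E))
    ((ContinuousLinearMap.fst ℝ 𝔷 E - b.comp (ContinuousLinearMap.snd ℝ 𝔷 E)).prod
      (ContinuousLinearMap.snd ℝ 𝔷 E))
    (fun p => by simp) (fun p => by simp)

theorem shearEquiv_apply (b : E →L[ℝ] 𝔷) (p : 𝔷 × E) : shearEquiv b p = (p.1 + b p.2, p.2) := rfl

include hS hS1 hT hT1 in
-- The bracket of the band is `(L(F), [·,·])` with `L(F) = ω + b ∘ [·,·]`, and the shear by `b` adds
-- exactly the term `b [x, y]` to `ω(x, y)`. It is the identity on `𝔷` and induces the identity on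
-- `𝔤`, and the differentials of the band's maps are the obvious inclusion and projection.
theorem bandIntegrates_lieStructure
    (hF : LCSmoothAt (E × E) 𝔷 (fun p : G × G => c.F p.1 p.2) 1) {ω : E → E → 𝔷}
    (hω : c.Integrates E ω) : BandIntegrates DS.lieStructure DT.lieStructure ω := by
  obtain ⟨b, hb⟩ := hω
  refine ⟨shearEquiv b, fun p q => ?_, fun z => ?_, fun p => ?_⟩
  · rw [lieAlgBracket_band hT hT1 hF]
    simp only [shearEquiv_apply, extBracket]
    rw [hb]
  · rw [tangentAt_quotMap hS hS1, tangentAt_bandInclLie hS hS1 hT hT1, shearEquiv_apply]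
    simp
  · rw [tangentAt_bandProjLie hT hT1, shearEquiv_apply]

end BandLieAlgebra

theorem mainTheorem7 {EA E 𝔷 A G : Type*}
    -- the model space of the Lie group `A`
    [AddCommGroup EA] [Module ℝ EA] [TopologicalSpace EA] [IsTopologicalAddGroup EA]
    [ContinuousSMul ℝ EA] [LocallyConvexSpace ℝ EA] [T2Space EA]
    -- the model space of the Lie group `G`, identified with the Lie algebra of `G`
    [AddCommGroup E] [Module ℝ E] [TopologicalSpace E] [IsTopologicalAddGroup E]
    [ContinuousSMul ℝ E] [LocallyConvexSpace ℝ E] [T2Space E]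
    -- the sequentially complete locally convex space `𝔷`
    [AddCommGroup 𝔷] [Module ℝ 𝔷] [TopologicalSpace 𝔷] [IsTopologicalAddGroup 𝔷]
    [ContinuousSMul ℝ 𝔷] [LocallyConvexSpace ℝ 𝔷] [T2Space 𝔷] (h𝔷 : SeqComplete 𝔷)
    -- the strict abelian Lie 2-group given by `τ : A → 𝔷`
    [AddCommGroup A] [TopologicalSpace A] [ChartedSpace EA A] [LCLieAddGroup EA A]
    (τ : A →+ 𝔷) (hτ : LCSmooth EA 𝔷 τ) (hdisc : DiscreteTopology τ.range)
    -- the simply connected Lie group `G`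
    [Group G] [TopologicalSpace G] [ChartedSpace E G] [LCLieGroup E G] [SimplyConnectedSpace G]
    (ω : E →ₗ[ℝ] E →ₗ[ℝ] 𝔷) (hω : IsLieCocycle (lieAlgBracket E G) ω)
    (c : GenCocycle τ G) (hc : c.IsSmooth EA E) (hint : c.Integrates E (fun x y => ω x y)) :
    ∃ (S : LieStructure 𝔷 (Multiplicative (𝔷 ⧸ τ.range))) (T : LieStructure (𝔷 × E) (Band c)),
      -- these are the natural Lie group structures on `𝔷 / τ(A)` and on the band, and the only ones
      (IsNaturalOnQuotient S ∧ ∀ S', IsNaturalOnQuotient S' → S.Coincide S') ∧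
      (IsNaturalOnBand T ∧ ∀ T', IsNaturalOnBand T' → T.Coincide T') ∧
      -- the band is a principal `𝔷 / τ(A)`-bundle over `G`
      IsSmoothPrincipalBundle 𝔷 (𝔷 × E) E
        (fun (h : S.Carrier) (b : T.Carrier) => bandInclLie S T h * b) (bandProjLie T) ∧
      -- it is a central extension of Lie groups
      IsCentralLieExtension 𝔷 (𝔷 × E) E (bandInclLie S T) (bandProjLie T) ∧
      -- which integrates `𝔷 → 𝔷 ⊕_ω 𝔤 → 𝔤`
      BandIntegrates S T (fun x y => ω x y) := by
  -- `LCSmoothAt` at the unit already means smoothness on a whole chart neighbourhood.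
  have hF := hc.smooth_F.self_of_nhds
  obtain ⟨DS, hS, hS1⟩ := exists_lieChart_quotient τ
  obtain ⟨DT, hT, hT1⟩ := exists_lieChart_band c hF
  exact ⟨DS.lieStructure, DT.lieStructure,
    ⟨isNaturalOnQuotient_lieStructure hS hS1,
      fun _ h => (isNaturalOnQuotient_lieStructure hS hS1).coincide h⟩,
    ⟨isNaturalOnBand_lieStructure hT hT1,
      fun _ h => (isNaturalOnBand_lieStructure hT hT1).coincide h⟩,
    isSmoothPrincipalBundle_band hS hS1 hT hT1, isCentralLieExtension_band hS hS1 hT hT1,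
    bandIntegrates_lieStructure hS hS1 hT hT1 hF hint⟩
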